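/- Let $K$ be a non-Archimedean local field with ring of integers $O$, residue field of cardinality $q$, and normalized absolute value $|\cdot|$ (so $|\beta|=q^{-1}$ for a prime element $\beta$). Let $dx$ be the Haar measure on $K$ with $\int_O dx=1$, let $n\ge 1$, and put $\|x\|=\max_j|x_j|$ and $\xi\cdot x=\xi_1x_1+\dots+\xi_nx_n$ on $K^n$. A function is called locally constant if it is invariant under all sufficiently small translations, with the same bound on the translations at all points. For bounded locally constant functions $u$ on $K$, respectively $K^n$, and $\alpha>0$ put $$(D^{\alpha}u)(x)=\frac{1-q^{\alpha}}{1-q^{-\alpha-1}}\int_{K}|y|^{-\alpha-1}[u(x-y)-u(x)]\,dy,\qquad (D^{\alpha,n}u)(x)=\frac{1-q^{\alpha}}{1-q^{-\alpha-n}}\int_{K^n}\|y\|^{-\alpha-n}[u(x-y)-u(x)]\,d^ny,$$ and let $D^0$ be the identity. Let $\varphi\in\mathcal D(K^n)$, that is, let $\varphi:K^n\to\mathbb C$ be locally constant with compact support. For $\xi\in K^n\setminus\{0\}$ and $s\in K$ let $\check\varphi(\xi,s)$ be the Radon transform of $\varphi$. For $n\ge2$ it is $\check\varphi(\xi,s)=\int_{\xi\cdot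 x=s}\varphi\,d\omega_{\xi,s}$, where $\omega_{\xi,s}$ is the measure on the hyperplane $\xi\cdot x=s$ given by $|\xi_j|^{-1}\prod_{i\ne j}dx_i$ for any $j$ with $\xi_j\ne0$, so that $\int_K ds\int_{\xi\cdot x=s}\psi\,d\omega_{\xi,s}=\int_{K^n}\psi\,dx$ for $\psi\in\mathcal D(K^n)$. For $n=1$ it is $\check\varphi(\xi,s)=\int_K\chi(-rs)\,\widetilde\varphi(r\xi)\,dr$, where $\chi$ is an additive character of $K$ of rank zero (trivial on $O$, but not on $\{x:|x|=q\}$) and $\widetilde\varphi(\eta)=\int_K\chi(x\eta)\varphi(x)\,dx$. For $t\in K$ and $x,u\in K^n$ with $\|u\|=1$ put $\Gamma(t,x,u)=\check\varphi(u,t+u\cdot x)$, and let $$F_1(t,x)=(1-q^{-1})^{-1}\int_{\|u\|=1}(D_t^{n-1}\Gamma)(t,x,u)\,d^nu,\qquad F_2(t,x)=(1-q^{-1})^{-1}\int_{\|u\|=1}\Gamma(t,x,u)\,d^nu .$$ Then all these integrals converge absolutely. Both $F=F_1$ and $F=F_2$ are radial in $t$ (they depend on $t$ only through $|t|$), jointly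 locally constant in $(t,x)\in K\times K^n$, and bounded, and for every $\alpha>0$ they satisfy $$D_t^{\alpha}F-D_x^{\alpha,n}F=0\quad\text{on } K\times K^n,$$ where the integrals that define $D_t^\alpha F$ and $D_x^{\alpha,n}F$ converge absolutely at every point. Moreover, for all $x\in K^n$, $$F_1(0,x)=\varphi(x),\qquad (D_t^{n-1}F_2)(0,x)=\varphi(x).$$ -/

import Mathlib

open MeasureTheory

noncomputable section

namespace NAWave

section Field

variable (K : Type*) [NontriviallyNormedField K] [IsUltrametricDist K]

/-- The ring of integers `O = {x : |x| ≤ 1}`, as a valuation subring. -/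
abbrev ringOfIntegers : ValuationSubring K :=
  (NormedField.valuation (K := K)).valuationSubring

/-- `q`, the cardinality of the residue field `O / P`. -/
def q : ℕ := Nat.card (IsLocalRing.ResidueField (ringOfIntegers K))

/-- The absolute value is normalized: a generator of the prime ideal `P` of `O` has
absolute value `q⁻¹`. -/
def IsNormalizedNorm : Prop :=
  ∃ β : ringOfIntegers K,
    IsLocalRing.maximalIdeal (ringOfIntegers K) = Ideal.span {β} ∧
      ‖(β : K)‖ = (q K : ℝ)⁻¹

/-- An additive character of rank zero: trivial on `O`, not trivial on `{|x| = q}`. -/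
structure IsRankZero (χ : AddChar K Circle) : Prop where
  continuous : Continuous χ
  eq_one : ∀ x : K, ‖x‖ ≤ 1 → χ x = 1
  ne_one : ∃ x : K, ‖x‖ = (q K : ℝ) ∧ χ x ≠ 1

variable [ProperSpace K] [MeasurableSpace K] [BorelSpace K]

/-- The Haar measure of the additive group of `K` for which `O` has measure `1`. -/
abbrev haar : Measure K :=
  Measure.addHaarMeasure
    ⟨⟨Metric.closedBall 0 1, isCompact_closedBall 0 1⟩,
      ⟨0, Metric.ball_subset_interior_closedBall (Metric.mem_ball_self one_pos)⟩⟩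

/-- The product measure `dy` on `K^ι`. On `Fin n → K`, Mathlib's norm is the maximum of the
absolute values of the coordinates. -/
abbrev haarPi (ι : Type*) [Fintype ι] : Measure (ι → K) :=
  Measure.pi fun _ => haar K

end Field

section Functions

/-- Local constancy with a radius of constancy that does not depend on the point. -/
def IsLocConst {E : Type*} [NormedAddCommGroup E] (f : E → ℂ) : Prop :=
  ∃ δ : ℝ, 0 < δ ∧ ∀ x x' : E, ‖x'‖ ≤ δ → f (x + x') = f x

/-- The Bruhat-Schwartz test functions. -/
def IsTestFunction {E : Type*} [NormedAddCommGroup E] (f : E → ℂ) : Prop :=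
  IsLocConst f ∧ HasCompactSupport f

end Functions

variable {K : Type*} [NontriviallyNormedField K] [IsUltrametricDist K]
  [ProperSpace K] [MeasurableSpace K] [BorelSpace K]

section Operators

/-- The integrand of the hypersingular integral that defines `D^α u` at the point `x`. -/
def fracIntegrand (α : ℝ) (u : K → ℂ) (x y : K) : ℂ :=
  ((‖y‖ ^ (-α - 1) : ℝ) : ℂ) * (u (x - y) - u x)

/-- Vladimirov's operator `D^α`, `α ≥ 0`, on bounded locally constant functions of one
variable; `D^0` is the identity. -/
def fracD (α : ℝ) (u : K → ℂ) (x : K) : ℂ :=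
  if α = 0 then u x
  else (((1 - (q K : ℝ) ^ α) / (1 - (q K : ℝ) ^ (-α - 1)) : ℝ) : ℂ) *
    ∫ y, fracIntegrand α u x y ∂(haar K)

/-- The integral that defines `(D^α u) x` converges absolutely (nothing to check for
`α = 0`). -/
def FracDExists (α : ℝ) (u : K → ℂ) (x : K) : Prop :=
  α = 0 ∨ Integrable (fracIntegrand α u x) (haar K)

variable {n : ℕ}

/-- The integrand of the hypersingular integral that defines `D^{α,n} u` at the point `x`. -/
def fracIntegrandN (α : ℝ) (u : (Fin n → K) → ℂ) (x y : Fin n → K) : ℂ :=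
  ((‖y‖ ^ (-α - (n : ℝ)) : ℝ) : ℂ) * (u (x - y) - u x)

/-- The operator `D^{α,n}`, `α > 0`, on bounded locally constant functions of `n`
variables. -/
def fracDN (α : ℝ) (u : (Fin n → K) → ℂ) (x : Fin n → K) : ℂ :=
  (((1 - (q K : ℝ) ^ α) / (1 - (q K : ℝ) ^ (-α - (n : ℝ))) : ℝ) : ℂ) *
    ∫ y, fracIntegrandN α u x y ∂(haarPi K (Fin n))

/-- The integral that defines `(D^{α,n} u) x` converges absolutely. -/
def FracDNExists (α : ℝ) (u : (Fin n → K) → ℂ) (x : Fin n → K) : Prop :=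
  Integrable (fracIntegrandN α u x) (haarPi K (Fin n))

/-- `F` satisfies `D_t^α F - D_x^{α,n} F = 0` at every point `(t, x)`, for every `α > 0`. -/
def SolvesWaveEq (F : K → (Fin n → K) → ℂ) : Prop :=
  ∀ α : ℝ, 0 < α → ∀ (t : K) (x : Fin n → K),
    FracDExists α (fun s => F s x) t ∧ FracDNExists α (F t) x ∧
      fracD α (fun s => F s x) t - fracDN α (F t) x = 0

end Operators

section Radon

variable {n : ℕ}

/-- The Fourier transform on `K^n`. -/
def fourier (χ : AddChar K Circle) (f : (Fin n → K) → ℂ) (ξ : Fin n → K) : ℂ :=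
  ∫ x, (χ (x ⬝ᵥ ξ) : ℂ) * f x ∂(haarPi K (Fin n))

/-- For `ξ j ≠ 0`, the point `x` of the hyperplane `ξ · x = s` whose coordinates other than the
`j`-th are `y`. -/
def hyperplanePoint (ξ : Fin n → K) (s : K) (j : Fin n) (y : {i : Fin n // i ≠ j} → K) :
    Fin n → K :=
  fun i => if h : i = j then (s - ∑ k : {i : Fin n // i ≠ j}, ξ k * y k) / ξ j else y ⟨i, h⟩

open Classical in
/-- The measure `ω_{ξ,s}`, `ξ ≠ 0`, on the hyperplane `ξ · x = s`, for which
`∫ ds ∫ ψ dω_{ξ,s} = ∫ ψ dx`. In the coordinates `x_i`, `i ≠ j`, of the hyperplane, where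
`ξ j ≠ 0`, it is `|ξ j|⁻¹ ∏_{i ≠ j} dx_i`, whatever the choice of `j`. -/
def hyperplaneMeasure (ξ : Fin n → K) (s : K) : Measure (Fin n → K) :=
  if h : ∃ j, ξ j ≠ 0 then
    ENNReal.ofReal (‖ξ h.choose‖⁻¹) •
      (haarPi K {i : Fin n // i ≠ h.choose}).map (hyperplanePoint ξ s h.choose)
  else 0

/-- The Radon transform: for `n ≥ 2` the integral over the hyperplane `ξ · x = r`; for `n = 1`
it is defined through the Fourier transform. -/
def radon (χ : AddChar K Circle) (φ : (Fin n → K) → ℂ) (ξ : Fin n → K) (r : K) : ℂ :=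
  if n = 1 then ∫ s, (χ (-(s * r)) : ℂ) * fourier χ φ (s • ξ) ∂(haar K)
  else ∫ x, φ x ∂(hyperplaneMeasure ξ r)

/-- `Γ(t, x, u)`. -/
def waveKernel (χ : AddChar K Circle) (φ : (Fin n → K) → ℂ) (t : K) (x u : Fin n → K) : ℂ :=
  radon χ φ u (t + u ⬝ᵥ x)

/-- `(D_t^{n-1} Γ)(t, x, u)`. -/
def waveKernelD (χ : AddChar K Circle) (φ : (Fin n → K) → ℂ) (t : K) (x u : Fin n → K) : ℂ :=
  fracD ((n : ℝ) - 1) (fun s => waveKernel χ φ s x u) t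

/-- `F₁`. -/
def F₁ (χ : AddChar K Circle) (φ : (Fin n → K) → ℂ) (t : K) (x : Fin n → K) : ℂ :=
  (1 - (q K : ℂ)⁻¹)⁻¹ *
    ∫ u in Metric.sphere (0 : Fin n → K) 1, waveKernelD χ φ t x u ∂(haarPi K (Fin n))

/-- `F₂`. -/
def F₂ (χ : AddChar K Circle) (φ : (Fin n → K) → ℂ) (t : K) (x : Fin n → K) : ℂ :=
  (1 - (q K : ℂ)⁻¹)⁻¹ *
    ∫ u in Metric.sphere (0 : Fin n → K) 1, waveKernel χ φ t x u ∂(haarPi K (Fin n))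

/-- The integrals in the definitions of `F₁` and `F₂` converge absolutely. -/
def IntegralsConverge (χ : AddChar K Circle) (φ : (Fin n → K) → ℂ) : Prop :=
  ∀ (t : K) (x : Fin n → K),
    (∀ u : Fin n → K, ‖u‖ = 1 →
      FracDExists ((n : ℝ) - 1) (fun s => waveKernel χ φ s x u) t) ∧
    IntegrableOn (waveKernelD χ φ t x) (Metric.sphere 0 1) (haarPi K (Fin n)) ∧
    IntegrableOn (waveKernel χ φ t x) (Metric.sphere 0 1) (haarPi K (Fin n))

end Radon

section Classes

variable {n : ℕ}

/-- `F(t, x)` depends on `t` only through `|t|`. -/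
def IsRadialInTime (F : K → (Fin n → K) → ℂ) : Prop :=
  ∀ (t t' : K) (x : Fin n → K), ‖t‖ = ‖t'‖ → F t x = F t' x

/-- Radial in `t`, jointly locally constant in `(t, x)`, bounded solutions of the wave
equation. -/
structure IsClassicalSolution (F : K → (Fin n → K) → ℂ) : Prop where
  radial : IsRadialInTime F
  locConst : IsLocConst (fun p : K × (Fin n → K) => F p.1 p.2)
  bounded : ∃ C : ℝ, ∀ (t : K) (x : Fin n → K), ‖F t x‖ ≤ C
  solves : SolvesWaveEq F

end Classes

end NAWave

end

/-!
The proof decomposes the solution into plane waves and the data into indicators of balls.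

*Plane waves.* For `‖u‖ = 1` and a bounded locally constant profile `g : K → ℂ`, the function
`g (t + u · x)` solves the wave equation. The automorphism of `K^n` that replaces a coordinate
`y j` with `|u j| = 1` by `u · y` preserves the norm, hence the Haar measure
(`measurePreserving_shearEquiv`). It turns `u · y` into a coordinate, and integrating
`‖y‖ ^ (-α - n)` over the other coordinates leaves a multiple of `|z| ^ (-α - 1)` whose constant
matches the normalizations of `D^{α,n}` and `D^α` (`integral_norm_rpow_mul_dotProduct`,
`fracDN_planeWave`). By Fubini's theorem, mean values over the sphere `‖u‖ = 1` of plane waves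
`G u (t + u · x)` are solutions as well; if `G (ε u) (ε s) = G u s` for units `ε`, they depend on
`t` only through `|t|` (`IsProfileFamily.isClassicalSolution`).

*The Radon transform.* A test function is a linear combination of indicators of balls of one radius
`r = ‖b‖`. For `‖u‖ = 1` the Radon transform of the indicator of the ball around `a` is
`r ^ (n - 1)` times the indicator of `|s - u · a| ≤ r`; for `n = 1` this is orthogonality of characters
(`radon_sum_ballIndicator`). So `F₁` and `F₂` are spherical means of explicit profiles, and
Fubini's theorem gives `D_t^{n-1} F₂ = F₁`.

*Inversion.* The operator `D^{n-1}` maps the indicator of the ball of radius `r` in `K` to an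
explicit radial function `tailProfile` (`fracD_ballIndicator`). Its mean value over the ball of
radius `R` is a constant times `max R r ^ (-n)` (`setIntegral_tailProfile`). The mean of
`tailProfile (u · x)` over the sphere is a difference of two of these, at radii `‖x‖` and `‖x‖ / q`
and with weights `1` and `q ^ (-n)`: it vanishes for `‖x‖ > r` and is constant for `‖x‖ ≤ r`
(`setIntegral_sphere_tailProfile`), which gives `F₁(0, x) = φ(x)`.
-/

open MeasureTheory Metric

namespace NAWave

/-! ### Norms and Haar measure of a local field -/

/-- The maximum norm on `K^ι` is attained at a coordinate. -/
theorem exists_norm_eq_norm {K ι : Type*} [NormedField K] [Fintype ι] [Nonempty ι]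
    (x : ι → K) : ∃ j, ‖x‖ = ‖x j‖ := by
  obtain ⟨j, -, hj⟩ := Finset.exists_max_image Finset.univ (fun i => ‖x i‖) Finset.univ_nonempty
  exact ⟨j, le_antisymm ((pi_norm_le_iff_of_nonneg (norm_nonneg _)).2
    fun i => hj i (Finset.mem_univ i)) (norm_le_pi_norm x j)⟩

theorem exists_norm_eq_one_and_eq_smul {K ι : Type*} [NormedField K] [Fintype ι] [Nonempty ι]
    (x : ι → K) : ∃ (a : K) (v : ι → K), ‖v‖ = 1 ∧ x = a • v := by
  obtain ⟨j, hj⟩ := exists_norm_eq_norm x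
  by_cases h : x j = 0
  · refine ⟨0, fun _ => 1, by simp, ?_⟩
    rw [h, norm_zero, norm_eq_zero] at hj
    simp [hj]
  · refine ⟨x j, (x j)⁻¹ • x, ?_, ?_⟩
    · rw [norm_smul, hj, norm_inv, inv_mul_cancel₀ (norm_ne_zero_iff.2 h)]
    · rw [smul_smul, mul_inv_cancel₀ h, one_smul]

theorem norm_eq_of_norm_sub_lt {E : Type*} [SeminormedAddCommGroup E] [IsUltrametricDist E]
    {x y : E} (h : ‖x - y‖ < ‖y‖) : ‖x‖ = ‖y‖ := by
  have := IsUltrametricDist.norm_add_eq_max_of_norm_ne_norm h.ne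
  rw [sub_add_cancel] at this
  rw [this, max_eq_right h.le]

/-- Multiplication by a nonzero scalar, as an automorphism of the topological group. -/
noncomputable def smulEquiv {K : Type*} [NormedField K] (E : Type*) [NormedAddCommGroup E]
    [NormedSpace K E] (a : K) (ha : a ≠ 0) : E ≃ₜ+ E :=
  { DistribMulAction.toAddEquiv₀ E a ha with
    continuous_toFun := continuous_const_smul a
    continuous_invFun := continuous_const_smul a⁻¹ }

@[simp]
theorem smulEquiv_apply {K E : Type*} [NormedField K] [NormedAddCommGroup E] [NormedSpace K E]
    (a : K) (ha : a ≠ 0) (x : E) : smulEquiv E a ha x = a • x := rfl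

theorem preimage_smulEquiv_closedBall {K E : Type*} [NormedField K] [NormedAddCommGroup E]
    [NormedSpace K E] (a : K) (ha : a ≠ 0) (r : ℝ) :
    smulEquiv E a ha ⁻¹' closedBall 0 (‖a‖ * r) = closedBall 0 r := by
  ext x
  simp [norm_smul, norm_pos_iff.2 ha]

section Field

variable {K : Type*} [NontriviallyNormedField K] [IsUltrametricDist K]

theorem mem_ringOfIntegers {x : K} : x ∈ ringOfIntegers K ↔ ‖x‖ ≤ 1 := by
  rw [Valuation.mem_valuationSubring_iff, NormedField.valuation_apply, ← NNReal.coe_le_coe]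
  simp

theorem mem_maximalIdeal {x : ringOfIntegers K} :
    x ∈ IsLocalRing.maximalIdeal (ringOfIntegers K) ↔ ‖(x : K)‖ < 1 := by
  rw [ValuationSubring.valuation_lt_one_iff, ← (NormedField.valuation
    (K := K)).isEquiv_valuation_valuationSubring.lt_one_iff_lt_one, NormedField.valuation_apply,
    ← NNReal.coe_lt_coe]
  simp

/-- Discreteness of the norm: the maximal ideal is the closed ball of radius `q⁻¹`. The
nontriviality of the norm excludes the infinite residue field, for which `q` would be `0`. -/
theorem exists_uniformizer (hK : IsNormalizedNorm K) :
    1 < (q K : ℝ) ∧ ∃ β : K, ‖β‖ = (q K : ℝ)⁻¹ ∧ ∀ x : K, ‖x‖ < 1 → ‖x‖ ≤ (q K : ℝ)⁻¹ := by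
  obtain ⟨β, hβ, hn⟩ := hK
  have key : ∀ x : K, ‖x‖ < 1 → ‖x‖ ≤ (q K : ℝ)⁻¹ := by
    intro x hx
    have h1 : (⟨x, mem_ringOfIntegers.2 hx.le⟩ : ringOfIntegers K) ∈
        IsLocalRing.maximalIdeal (ringOfIntegers K) := mem_maximalIdeal.2 hx
    rw [hβ, Ideal.mem_span_singleton] at h1
    obtain ⟨c, hc⟩ := h1
    have h2 : x = (β : K) * c := congrArg Subtype.val hc
    rw [h2, norm_mul, hn]
    exact mul_le_of_le_one_right (by positivity) (mem_ringOfIntegers.1 c.2)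
  refine ⟨?_, β, hn, key⟩
  have h0 : q K ≠ 0 := by
    intro h0
    obtain ⟨x, hx0, hx⟩ := NormedField.exists_norm_lt_one K
    have := key x hx
    simp [h0] at this
    simp [this] at hx0
  have h1 : q K ≠ 1 := by
    intro h1
    have := (Nat.card_eq_one_iff_unique.1 h1).1
    exact not_subsingleton (IsLocalRing.ResidueField (ringOfIntegers K)) this
  exact_mod_cast (show 1 < q K by omega)

theorem one_lt_q (hK : IsNormalizedNorm K) : 1 < (q K : ℝ) := (exists_uniformizer hK).1

theorem exists_norm_eq_zpow (hK : IsNormalizedNorm K) {x : K} (hx : x ≠ 0) :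
    ∃ k : ℤ, ‖x‖ = (q K : ℝ) ^ k := by
  obtain ⟨hq, β, hβ, hmax⟩ := exists_uniformizer hK
  have hq0 : (0 : ℝ) < q K := by positivity
  obtain ⟨k, hk1, hk2⟩ := exists_mem_Ico_zpow (norm_pos_iff.2 hx) hq
  refine ⟨k, le_antisymm ?_ hk1⟩
  by_contra! hlt
  -- an element of norm strictly between `q ^ k` and `q ^ (k + 1)` would rescale into
  -- the maximal ideal with norm above `q⁻¹`
  have hy : ‖x * β ^ (k + 1)‖ = ‖x‖ / (q K : ℝ) ^ (k + 1) := by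
    rw [norm_mul, norm_zpow, hβ, inv_zpow, div_eq_mul_inv]
  have h1 := hmax (x * β ^ (k + 1)) (by rw [hy, div_lt_one (by positivity)]; exact hk2)
  rw [hy, div_le_iff₀ (by positivity), zpow_add_one₀ hq0.ne'] at h1
  field_simp at h1
  linarith

/-- There are no norms between `‖a‖` and `q * ‖a‖`. -/
theorem norm_le_of_norm_lt (hK : IsNormalizedNorm K) {x a : K} (h : ‖x‖ < ‖a‖ * q K) :
    ‖x‖ ≤ ‖a‖ := by
  obtain ⟨hq, β, hβ, hmax⟩ := exists_uniformizer hK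
  have hq0 : (0 : ℝ) < q K := by positivity
  have ha : 0 < ‖a‖ := by
    by_contra! h0
    nlinarith [norm_nonneg x]
  have h1 := hmax (x * a⁻¹ * β) (by
    rw [norm_mul, norm_mul, norm_inv, hβ]; field_simp; linarith)
  rw [norm_mul, norm_mul, norm_inv, hβ] at h1
  field_simp at h1
  linarith

variable {ι : Type*} [Fintype ι]

theorem pi_norm_le_of_norm_lt (hK : IsNormalizedNorm K) {x : ι → K} {a : K}
    (h : ‖x‖ < ‖a‖ * q K) : ‖x‖ ≤ ‖a‖ :=
  (pi_norm_le_iff_of_nonneg (norm_nonneg _)).2 fun i =>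
    norm_le_of_norm_lt hK ((norm_le_pi_norm x i).trans_lt h)

theorem norm_dotProduct_le (u x : ι → K) : ‖u ⬝ᵥ x‖ ≤ ‖u‖ * ‖x‖ := by
  refine IsUltrametricDist.norm_sum_le_of_forall_le_of_nonneg (by positivity) fun i _ => ?_
  rw [norm_mul]
  gcongr <;> exact norm_le_pi_norm _ i

end Field

section Measure

variable {K : Type*} [NontriviallyNormedField K] [IsUltrametricDist K] [ProperSpace K]
  [MeasurableSpace K] [BorelSpace K] {ι : Type*} [Fintype ι]

theorem haar_closedBall_one : haar K (closedBall 0 1) = 1 :=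
  Measure.addHaarMeasure_self

theorem haarPi_closedBall_one : haarPi K ι (closedBall 0 1) = 1 := by
  rw [Measure.pi_closedBall _ _ zero_le_one]
  simp [haar_closedBall_one]

/-- The image of a Haar measure under an automorphism is a multiple of it, and the factor can be
read off on a set `B` of measure `1`. -/
theorem map_eq_smul_of_preimage {E : Type*} [NormedAddCommGroup E] [ProperSpace E]
    [MeasurableSpace E] [BorelSpace E] (μ : Measure E) [μ.IsAddHaarMeasure]
    (e : E ≃ₜ+ E) {B : Set E} (hm : MeasurableSet B) (hB : μ B = 1) :
    μ.map e = μ (e ⁻¹' B) • μ := by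
  have := e.isAddHaarMeasure_map μ
  have h := Measure.isAddLeftInvariant_eq_smul (μ.map e) μ
  have h2 := congrArg (fun ν => ν B) h
  simp only [Measure.smul_apply, hB] at h2
  rw [Measure.map_apply (show Measurable e from e.continuous.measurable) hm] at h2
  rw [ENNReal.smul_def, smul_eq_mul, mul_one] at h2
  refine h.trans ?_
  rw [h2]
  rfl

/-- An additive automorphism that preserves the norm preserves the Haar measure. -/
theorem measurePreserving_of_norm_eq (e : (ι → K) ≃ₜ+ (ι → K)) (he : ∀ x, ‖e x‖ = ‖x‖) :
    MeasurePreserving e (haarPi K ι) (haarPi K ι) := by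
  refine ⟨e.continuous.measurable, ?_⟩
  rw [map_eq_smul_of_preimage _ e isClosed_closedBall.measurableSet haarPi_closedBall_one]
  have : e ⁻¹' closedBall 0 1 = closedBall 0 1 := by ext; simp [he]
  rw [this, haarPi_closedBall_one, one_smul]

/-- The ring of integers is the disjoint union of `q` translates of the maximal ideal. -/
theorem haar_ball_one (hK : IsNormalizedNorm K) : haar K (ball 0 1) = (q K : ENNReal)⁻¹ := by
  have hq := one_lt_q hK
  set k := IsLocalRing.ResidueField (ringOfIntegers K)
  have : Finite k := Nat.finite_of_card_ne_zero (by
    intro h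
    have : q K = 0 := h
    simp [this] at hq
    linarith)
  have : Fintype k := Fintype.ofFinite k
  obtain ⟨s, hs⟩ := (IsLocalRing.residue_surjective (R := ringOfIntegers K)).hasRightInverse
  have hres : ∀ a b : ringOfIntegers K, IsLocalRing.residue (ringOfIntegers K) a =
      IsLocalRing.residue (ringOfIntegers K) b ↔ ‖(a : K) - b‖ < 1 := by
    intro a b
    rw [← sub_eq_zero, ← map_sub, IsLocalRing.residue_eq_zero_iff, mem_maximalIdeal]
    simp
  have hU : closedBall (0 : K) 1 = ⋃ c : k, ball (s c : K) 1 := by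
    ext x
    simp only [mem_closedBall, Set.mem_iUnion, mem_ball, dist_eq_norm, sub_zero]
    constructor
    · intro hx
      refine ⟨IsLocalRing.residue _ ⟨x, mem_ringOfIntegers.2 hx⟩, ?_⟩
      exact (hres ⟨x, mem_ringOfIntegers.2 hx⟩ _).1 (hs _).symm
    · rintro ⟨c, hc⟩
      have h1 := mem_ringOfIntegers.1 (s c).2
      have := IsUltrametricDist.norm_add_le_max (x - s c) (s c : K)
      rw [sub_add_cancel] at this
      exact this.trans (max_le hc.le h1)
  have hd : Pairwise (Function.onFun Disjoint fun c : k => ball (s c : K) 1) := by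
    intro c d hcd
    refine Set.disjoint_left.2 fun x hx hy => hcd ?_
    rw [← hs c, ← hs d, hres]
    rw [mem_ball, dist_eq_norm] at hx hy
    have := IsUltrametricDist.norm_add_le_max (x - s d : K) (-(x - s c))
    rw [norm_neg, ← sub_eq_add_neg, sub_sub_sub_cancel_left] at this
    exact this.trans_lt (max_lt hy hx)
  have h1 := haar_closedBall_one (K := K)
  rw [hU, measure_iUnion hd fun _ => isOpen_ball.measurableSet] at h1
  simp only [Measure.addHaar_ball_center, tsum_fintype, Finset.sum_const, nsmul_eq_mul,
    Finset.card_univ, ← Nat.card_eq_fintype_card] at h1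
  exact ENNReal.eq_inv_of_mul_eq_one_left (by rw [mul_comm]; exact h1)

theorem haar_closedBall_uniformizer (hK : IsNormalizedNorm K) {β : K}
    (hβ : ‖β‖ = (q K : ℝ)⁻¹) : haar K (closedBall 0 ‖β‖) = ENNReal.ofReal ‖β‖ := by
  have hq := one_lt_q hK
  have : closedBall (0 : K) ‖β‖ = ball 0 1 := by
    ext x
    simp only [mem_closedBall, mem_ball, dist_zero_right]
    refine ⟨fun h => h.trans_lt ?_, fun h => norm_le_of_norm_lt hK (h.trans_eq ?_)⟩
    · rw [hβ]; exact inv_lt_one_of_one_lt₀ hq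
    · rw [hβ, inv_mul_cancel₀ (by positivity)]
  rw [this, haar_ball_one hK, hβ, ENNReal.ofReal_inv_of_pos (by positivity),
    ENNReal.ofReal_natCast]

/-- The Haar measure of a ball centred at `0` is its radius. -/
theorem haar_closedBall (hK : IsNormalizedNorm K) (a : K) :
    haar K (closedBall 0 ‖a‖) = ENNReal.ofReal ‖a‖ := by
  obtain ⟨hq, β, hβ, hmax⟩ := exists_uniformizer hK
  have hβ0 : β ≠ 0 := by rw [← norm_pos_iff, hβ]; positivity
  -- one step: enlarging the radius by `q` multiplies the measure by `q`
  have step : ∀ r : ℝ, haar K (closedBall 0 (‖β‖ * r)) =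
      ENNReal.ofReal ‖β‖ * haar K (closedBall 0 r) := by
    have hmap := map_eq_smul_of_preimage (haar K) (smulEquiv K β hβ0).symm
      isClosed_closedBall.measurableSet haar_closedBall_one
    have hpre : (smulEquiv K β hβ0).symm ⁻¹' closedBall 0 1 = closedBall 0 ‖β‖ := by
      rw [← preimage_smulEquiv_closedBall β hβ0 1, mul_one]
      ext x
      simp [-mem_closedBall]
    rw [hpre, haar_closedBall_uniformizer hK hβ] at hmap
    intro r
    have h2 := congrArg (fun ν => ν (closedBall 0 r)) hmap
    simp only [Measure.smul_apply, smul_eq_mul] at h2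
    rw [← h2, Measure.map_apply
      (show Measurable (smulEquiv K β hβ0).symm from
        (smulEquiv K β hβ0).symm.continuous.measurable)
      isClosed_closedBall.measurableSet, ← preimage_smulEquiv_closedBall β hβ0 r]
    congr 1
    ext x
    simp [-mem_closedBall]
  have hβn : ENNReal.ofReal ‖β‖ ≠ 0 := by simpa using hβ0
  have key : ∀ k : ℤ, haar K (closedBall 0 (‖β‖ ^ k)) = ENNReal.ofReal (‖β‖ ^ k) := by
    have hpos : 0 < ‖β‖ := norm_pos_iff.2 hβ0
    intro k
    induction k using Int.induction_on with
    | zero => simpa using haar_closedBall_one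
    | succ i ih =>
      rw [zpow_add_one₀ hpos.ne', mul_comm, step, ih, ENNReal.ofReal_mul hpos.le]
    | pred i ih =>
      have h := step (‖β‖ ^ (-(i : ℤ) - 1))
      have h3 : ‖β‖ * ‖β‖ ^ (-(i : ℤ) - 1) = ‖β‖ ^ (-(i : ℤ)) := by
        rw [← zpow_one_add₀ hpos.ne']; congr 1; ring
      rw [h3, ih, ← h3, ENNReal.ofReal_mul hpos.le] at h
      exact ((ENNReal.mul_right_inj hβn ENNReal.ofReal_ne_top).1 h).symm
  by_cases ha : a = 0
  · subst ha
    simp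
  · obtain ⟨k, hk⟩ := exists_norm_eq_zpow hK ha
    have : ‖a‖ = ‖β‖ ^ (-k) := by rw [hk, hβ, inv_zpow', neg_neg]
    rw [this, key]

theorem haar_closedBall_center (hK : IsNormalizedNorm K) (x a : K) :
    haar K (closedBall x ‖a‖) = ENNReal.ofReal ‖a‖ := by
  rw [Measure.addHaar_closedBall_center, haar_closedBall hK]

theorem haarPi_closedBall (hK : IsNormalizedNorm K) (x : ι → K) (a : K) :
    haarPi K ι (closedBall x ‖a‖) = ENNReal.ofReal (‖a‖ ^ Fintype.card ι) := by
  rw [Measure.pi_closedBall _ _ (norm_nonneg a)]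
  simp [haar_closedBall_center hK, ENNReal.ofReal_pow]

theorem haarPi_real_closedBall (hK : IsNormalizedNorm K) (x : ι → K) (a : K) :
    (haarPi K ι).real (closedBall x ‖a‖) = ‖a‖ ^ Fintype.card ι := by
  rw [Measure.real, haarPi_closedBall hK, ENNReal.toReal_ofReal (by positivity)]

theorem haar_real_closedBall (hK : IsNormalizedNorm K) (x a : K) :
    (haar K).real (closedBall x ‖a‖) = ‖a‖ := by
  rw [Measure.real, haar_closedBall_center hK, ENNReal.toReal_ofReal (by positivity)]

/-- The homothety `x ↦ a x` of `K^ι` has modulus `‖a‖ ^ card ι`. -/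
theorem integral_comp_smul (hK : IsNormalizedNorm K) {a : K} (ha : a ≠ 0) (f : (ι → K) → ℂ) :
    ∫ x, f x ∂(haarPi K ι) = (‖a‖ : ℂ) ^ Fintype.card ι * ∫ x, f (a • x) ∂(haarPi K ι) := by
  have hmap := map_eq_smul_of_preimage (haarPi K ι) (smulEquiv (ι → K) a ha)
      isClosed_closedBall.measurableSet haarPi_closedBall_one
  have hpre : smulEquiv (ι → K) a ha ⁻¹' closedBall 0 1 = closedBall 0 ‖a⁻¹‖ := by
    rw [← preimage_smulEquiv_closedBall a ha ‖a⁻¹‖, norm_inv,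
      mul_inv_cancel₀ (norm_ne_zero_iff.2 ha)]
  rw [hpre, haarPi_closedBall hK] at hmap
  have h2 : ∫ x, f (a • x) ∂(haarPi K ι) = ∫ x, f x ∂((haarPi K ι).map (smulEquiv _ a ha)) :=
    ((smulEquiv (ι → K) a ha).toHomeomorph.measurableEmbedding.integral_map f).symm
  have hn : (‖a‖ : ℂ) ≠ 0 := by simpa using ha
  rw [h2, hmap, integral_smul_measure, ENNReal.toReal_ofReal (by positivity), norm_inv,
    Complex.real_smul]
  push_cast
  rw [inv_pow, mul_inv_cancel_left₀ (pow_ne_zero _ hn)]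

/-- Every integral over `K` is an integral over `K^{Unit}`. -/
theorem integral_haar_eq_haarPi (f : K → ℂ) :
    ∫ x, f x ∂(haar K) = ∫ x, f (x ()) ∂(haarPi K Unit) :=
  ((measurePreserving_funUnique (haar K) Unit).integral_comp
    (MeasurableEquiv.funUnique Unit K).measurableEmbedding f).symm

end Measure

/-! ### The shear and integrals of radial functions -/

section Shear

variable {K ι : Type*} [Fintype ι] [DecidableEq ι]

theorem dotProduct_update [CommRing K] (u y : ι → K) (j : ι) (c : K) :
    u ⬝ᵥ Function.update y j c = u ⬝ᵥ y + u j * (c - y j) := by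
  have : Function.update y j c = y + Pi.single j (c - y j) := by
    ext i
    by_cases h : i = j
    · subst h; simp
    · simp [h]
  rw [this, dotProduct_add, dotProduct_single]

variable [NontriviallyNormedField K]

/-- The automorphism of `K^ι` that replaces the coordinate `y j` by `u · y`, for `u j ≠ 0`. It
turns the linear form `u · y` into a coordinate. -/
def shearEquiv (u : ι → K) (j : ι) (hj : u j ≠ 0) : (ι → K) ≃ₜ+ (ι → K) where
  toFun y := Function.update y j (u ⬝ᵥ y)
  invFun z := Function.update z j (z j + (z j - u ⬝ᵥ z) / u j)
  left_inv y := by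
    simp only [Function.update_self, Function.update_idem, dotProduct_update]
    rw [Function.update_eq_self_iff]
    field_simp
    ring
  right_inv z := by
    simp only [Function.update_idem, dotProduct_update]
    rw [Function.update_eq_self_iff]
    field_simp
    ring
  map_add' y z := by
    rw [dotProduct_add, Function.update_add]
  continuous_toFun := by
    have : Continuous fun y : ι → K => u ⬝ᵥ y := by simp only [dotProduct]; fun_prop
    exact continuous_id.update j this
  continuous_invFun := by
    refine continuous_id.update j ?_
    simp only [dotProduct]
    fun_prop

theorem shearEquiv_apply (u : ι → K) (j : ι) (hj : u j ≠ 0) (y : ι → K) :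
    shearEquiv u j hj y = Function.update y j (u ⬝ᵥ y) := rfl

theorem shearEquiv_symm_apply (u : ι → K) (j : ι) (hj : u j ≠ 0) (z : ι → K) :
    (shearEquiv u j hj).symm z = Function.update z j (z j + (z j - u ⬝ᵥ z) / u j) := rfl

theorem norm_update_le {y : ι → K} {j : ι} {c : K} (hc : ‖c‖ ≤ ‖y‖) :
    ‖Function.update y j c‖ ≤ ‖y‖ := by
  refine (pi_norm_le_iff_of_nonneg (norm_nonneg _)).2 fun i => ?_
  by_cases h : i = j
  · subst h; simpa using hc
  · simpa [h] using norm_le_pi_norm y i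

theorem norm_shearEquiv [IsUltrametricDist K] {u : ι → K} (hu : ‖u‖ = 1) {j : ι}
    (hj : u j ≠ 0) (hj1 : ‖u j‖ = 1) (y : ι → K) : ‖shearEquiv u j hj y‖ = ‖y‖ := by
  have hdot : ∀ z : ι → K, ‖u ⬝ᵥ z‖ ≤ ‖z‖ := fun z => by
    simpa [hu] using norm_dotProduct_le u z
  refine le_antisymm (norm_update_le (hdot y)) ?_
  conv_lhs => rw [← (shearEquiv u j hj).symm_apply_apply y]
  rw [shearEquiv_symm_apply]
  refine norm_update_le ?_
  set z := shearEquiv u j hj y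
  refine (IsUltrametricDist.norm_add_le_max _ _).trans (max_le (norm_le_pi_norm z j) ?_)
  rw [norm_div, hj1, div_one, sub_eq_add_neg]
  refine (IsUltrametricDist.norm_add_le_max _ _).trans (max_le (norm_le_pi_norm z j) ?_)
  rw [norm_neg]
  exact hdot z

theorem measurePreserving_shearEquiv [IsUltrametricDist K] [ProperSpace K] [MeasurableSpace K]
    [BorelSpace K] {u : ι → K} (hu : ‖u‖ = 1) {j : ι} (hj : u j ≠ 0) (hj1 : ‖u j‖ = 1) :
    MeasurePreserving (shearEquiv u j hj) (haarPi K ι) (haarPi K ι) :=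
  measurePreserving_of_norm_eq _ (norm_shearEquiv hu hj hj1)

end Shear

section Norm

variable {K : Type*} [NontriviallyNormedField K] [IsUltrametricDist K] {ι : Type*} [Fintype ι]

theorem ball_eq_closedBall (hK : IsNormalizedNorm K) {β : K} (hβ : ‖β‖ = (q K : ℝ)⁻¹) {a : K}
    (ha : a ≠ 0) : ball (0 : ι → K) ‖a‖ = closedBall 0 ‖β * a‖ := by
  have hq := one_lt_q hK
  have ha' := norm_pos_iff.2 ha
  ext x
  simp only [mem_closedBall, mem_ball, dist_zero_right]
  refine ⟨fun h => pi_norm_le_of_norm_lt hK (h.trans_eq ?_), fun h => h.trans_lt ?_⟩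
  · rw [norm_mul, hβ]; field_simp
  · rw [norm_mul, hβ]
    exact mul_lt_of_lt_one_left ha' (inv_lt_one_of_one_lt₀ hq)

theorem rpow_mul_pow_lt_one (hK : IsNormalizedNorm K) {m : ℕ} {γ : ℝ} (hγ : m < γ) :
    (q K : ℝ) ^ m * (q K : ℝ) ^ (-γ) < 1 := by
  have hq := one_lt_q hK
  rw [← Real.rpow_natCast, ← Real.rpow_add (by positivity)]
  exact Real.rpow_lt_one_of_one_lt_of_neg hq (by linarith)

theorem setOf_norm_lt_eq_iUnion (hK : IsNormalizedNorm K) {b : K} (hb : b ≠ 0) :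
    {y : ι → K | ‖b‖ < ‖y‖} = ⋃ k : ℕ, sphere 0 (‖b‖ * (q K : ℝ) ^ (k + 1)) := by
  have hq := one_lt_q hK
  have hb' := norm_pos_iff.2 hb
  have hq0 : (0 : ℝ) < q K := by positivity
  ext y
  simp only [Set.mem_ofPred_eq, Set.mem_iUnion, mem_sphere, dist_zero_right]
  constructor
  · intro h
    have : Nonempty ι := by
      by_contra h0
      rw [not_nonempty_iff] at h0
      rw [Subsingleton.elim y 0, norm_zero] at h
      linarith
    obtain ⟨j, hj⟩ := exists_norm_eq_norm y
    rw [hj] at h ⊢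
    have hy : y j ≠ 0 := norm_pos_iff.1 (hb'.trans h)
    obtain ⟨k, hk⟩ := exists_norm_eq_zpow hK hy
    obtain ⟨l, hl⟩ := exists_norm_eq_zpow hK hb
    rw [hk, hl] at h ⊢
    have hlt : l < k := (zpow_lt_zpow_iff_right₀ hq).1 h
    refine ⟨(k - l - 1).toNat, ?_⟩
    rw [← zpow_natCast, ← zpow_add₀ hq0.ne']
    congr 1
    push_cast
    rw [Int.toNat_of_nonneg (by omega)]
    ring
  · rintro ⟨k, hk⟩
    rw [hk]
    exact lt_mul_of_one_lt_right hb' (one_lt_pow₀ hq (by omega))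

end Norm

section Radial

variable {K : Type*} [NontriviallyNormedField K] [IsUltrametricDist K] [ProperSpace K]
  [MeasurableSpace K] [BorelSpace K] {ι : Type*} [Fintype ι]

theorem haarPi_real_sphere (hK : IsNormalizedNorm K) {a : K} (ha : a ≠ 0) :
    (haarPi K ι).real (sphere 0 ‖a‖) =
      ‖a‖ ^ Fintype.card ι * (1 - ((q K : ℝ) ^ Fintype.card ι)⁻¹) := by
  obtain ⟨hq, β, hβ, -⟩ := exists_uniformizer hK
  rw [← closedBall_sdiff_ball, measureReal_sdiff ball_subset_closedBall isOpen_ball.measurableSet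
      (isCompact_closedBall _ _).measure_lt_top.ne,
    ball_eq_closedBall hK hβ ha, haarPi_real_closedBall hK, haarPi_real_closedBall hK, norm_mul,
    hβ]
  ring

/-- The tail of the radial function `‖y‖ ^ (-γ)` on `K^ι` converges for `γ > card ι`; it is a
geometric series over the spheres. -/
theorem integral_norm_rpow_tail (hK : IsNormalizedNorm K) {γ : ℝ} (hγ : Fintype.card ι < γ)
    {b : K} (hb : b ≠ 0) :
    IntegrableOn (fun y : ι → K => ‖y‖ ^ (-γ)) {y | ‖b‖ < ‖y‖} (haarPi K ι) ∧
    ∫ y in {y : ι → K | ‖b‖ < ‖y‖}, ‖y‖ ^ (-γ) ∂(haarPi K ι) =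
      ‖b‖ ^ (-γ) * ‖b‖ ^ Fintype.card ι * (((q K : ℝ) ^ Fintype.card ι - 1) *
        (q K : ℝ) ^ (-γ) / (1 - (q K : ℝ) ^ Fintype.card ι * (q K : ℝ) ^ (-γ))) := by
  obtain ⟨hq, β, hβ, -⟩ := exists_uniformizer hK
  have hq0 : (0 : ℝ) < q K := by positivity
  have hb' := norm_pos_iff.2 hb
  set m := Fintype.card ι with hm
  have hr := rpow_mul_pow_lt_one hK hγ
  rw [setOf_norm_lt_eq_iUnion hK hb]
  set s : ℕ → Set (ι → K) := fun k => sphere 0 (‖b‖ * (q K : ℝ) ^ (k + 1)) with hs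
  have hsm : ∀ k, MeasurableSet (s k) := fun k => isClosed_sphere.measurableSet
  have hcongr : ∀ k, Set.EqOn (fun y : ι → K => ‖y‖ ^ (-γ))
      (fun _ => (‖b‖ * (q K : ℝ) ^ (k + 1)) ^ (-γ)) (s k) := by
    intro k y hy
    rw [hs, mem_sphere_zero_iff_norm] at hy
    simp only [hy]
  have hfin : ∀ k, (haarPi K ι) (s k) ≠ ⊤ := fun k => (isCompact_sphere _ _).measure_lt_top.ne
  have hint : ∀ k, IntegrableOn (fun y : ι → K => ‖y‖ ^ (-γ)) (s k) (haarPi K ι) := fun k =>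
    (integrableOn_congr_fun (hcongr k) (hsm k)).2 (integrableOn_const (hfin k))
  have hβ0 : β ≠ 0 := by rw [← norm_pos_iff, hβ]; positivity
  have hval : ∀ k, ∫ y in s k, ‖y‖ ^ (-γ) ∂(haarPi K ι) =
      (‖b‖ ^ (-γ) * ‖b‖ ^ m * (((q K : ℝ) ^ m - 1) * (q K : ℝ) ^ (-γ))) *
        ((q K : ℝ) ^ m * (q K : ℝ) ^ (-γ)) ^ k := by
    intro k
    have hnorm : ‖b‖ * (q K : ℝ) ^ (k + 1) = ‖b * (β ^ (k + 1))⁻¹‖ := by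
      rw [norm_mul, norm_inv, norm_pow, hβ, inv_pow, inv_inv]
    have hvol : (haarPi K ι).real (s k) =
        (‖b‖ * (q K : ℝ) ^ (k + 1)) ^ m * (1 - ((q K : ℝ) ^ m)⁻¹) := by
      simp only [hs]
      rw [hnorm, haarPi_real_sphere hK (mul_ne_zero hb (inv_ne_zero (pow_ne_zero _ hβ0)))]
    rw [setIntegral_congr_fun (hsm k) (hcongr k), setIntegral_const, smul_eq_mul, hvol,
      Real.mul_rpow hb'.le (by positivity), ← Real.rpow_pow_comm hq0.le,
      mul_pow, mul_pow, ← pow_mul, ← pow_mul, pow_succ ((q K : ℝ) ^ (-γ)),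
      mul_comm (k + 1) m, mul_add, pow_add, mul_one]
    field_simp
  have hd : Pairwise (Function.onFun Disjoint s) := by
    intro k l hkl
    refine Set.disjoint_left.2 fun y hy hy' => hkl ?_
    simp only [hs, mem_sphere, dist_zero_right] at hy hy'
    rw [hy] at hy'
    have := (pow_right_injective₀ hq0 hq.ne') (mul_left_cancel₀ hb'.ne' hy')
    omega
  have hgeom := (hasSum_geometric_of_lt_one (by positivity) hr).mul_left
    (‖b‖ ^ (-γ) * ‖b‖ ^ m * (((q K : ℝ) ^ m - 1) * (q K : ℝ) ^ (-γ)))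
  simp only [← hval] at hgeom
  have hI : IntegrableOn (fun y : ι → K => ‖y‖ ^ (-γ)) (⋃ k, s k) (haarPi K ι) := by
    refine integrableOn_iUnion_of_summable_integral_norm hint ?_
    refine hgeom.summable.congr fun k => ?_
    refine integral_congr_ae (Filter.Eventually.of_forall fun y => ?_)
    simp only [Real.norm_eq_abs]
    rw [abs_of_nonneg (by positivity)]
  refine ⟨hI, ?_⟩
  rw [integral_iUnion hsm hd hI, hgeom.tsum_eq, ← div_eq_mul_inv, mul_div_assoc]

/-- The tail of `‖y‖ ^ (-γ)` is integrable with any positive cutoff. -/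
theorem integrableOn_norm_rpow (hK : IsNormalizedNorm K) {γ : ℝ} (hγ : Fintype.card ι < γ)
    {δ : ℝ} (hδ : 0 < δ) :
    IntegrableOn (fun y : ι → K => ‖y‖ ^ (-γ)) {y | δ < ‖y‖} (haarPi K ι) := by
  obtain ⟨b, hb0, hb⟩ := NormedField.exists_norm_lt K hδ
  exact (integral_norm_rpow_tail hK hγ (norm_pos_iff.1 hb0)).1.mono_set
    fun y hy => hb.trans hy

theorem setIntegral_haar_eq_haarPi (f : K → ℝ) (s : Set K) :
    ∫ y in s, f y ∂(haar K) =
      ∫ y in (fun x : Unit → K => x ()) ⁻¹' s, f (y ()) ∂(haarPi K Unit) :=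
  ((measurePreserving_funUnique (haar K) Unit).setIntegral_preimage_emb
    (MeasurableEquiv.funUnique Unit K).measurableEmbedding f s).symm

theorem integrableOn_haar_norm_rpow (hK : IsNormalizedNorm K) {γ : ℝ} (hγ : 1 < γ)
    {δ : ℝ} (hδ : 0 < δ) :
    IntegrableOn (fun y : K => ‖y‖ ^ (-γ)) {y | δ < ‖y‖} (haar K) := by
  have h := integrableOn_norm_rpow (ι := Unit) hK (γ := γ) (by simpa using hγ) hδ
  rw [← (measurePreserving_funUnique (haar K) Unit).integrableOn_comp_preimage
    (MeasurableEquiv.funUnique Unit K).measurableEmbedding]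
  have hnorm : ∀ y : Unit → K, ‖y‖ = ‖y ()‖ := fun y => 
    (exists_norm_eq_norm y).choose_spec
  simp only [hnorm] at h
  exact h

theorem integral_haar_norm_rpow_tail (hK : IsNormalizedNorm K) {γ : ℝ} (hγ : 1 < γ)
    {b : K} (hb : b ≠ 0) :
    ∫ y in {y : K | ‖b‖ < ‖y‖}, ‖y‖ ^ (-γ) ∂(haar K) =
      ‖b‖ ^ (-γ) * ‖b‖ * (((q K : ℝ) - 1) *
        (q K : ℝ) ^ (-γ) / (1 - (q K : ℝ) * (q K : ℝ) ^ (-γ))) := by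
  have h := (integral_norm_rpow_tail (ι := Unit) hK (γ := γ) (by simpa using hγ) hb).2
  have hnorm : ∀ y : Unit → K, ‖y‖ = ‖y ()‖ := fun y => 
    (exists_norm_eq_norm y).choose_spec
  simp only [hnorm, Fintype.card_unit, pow_one] at h
  rw [setIntegral_haar_eq_haarPi, ← h]
  rfl

/-- The integral along a fibre of the linear form `y ↦ y j`, normalized by `|y j| = 1`. -/
theorem integral_max_one_norm_rpow (hK : IsNormalizedNorm K) {γ : ℝ}
    (hγ : Fintype.card ι < γ) :
    ∫ y : ι → K, (max 1 ‖y‖) ^ (-γ) ∂(haarPi K ι) =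
      (1 - (q K : ℝ) ^ (-γ)) / (1 - (q K : ℝ) ^ Fintype.card ι * (q K : ℝ) ^ (-γ)) := by
  have hr := rpow_mul_pow_lt_one hK hγ
  obtain ⟨hI, hv⟩ := integral_norm_rpow_tail (ι := ι) hK hγ (one_ne_zero (α := K))
  simp only [norm_one, Real.one_rpow, one_pow, one_mul] at hI hv
  have hcompl : (closedBall (0 : ι → K) 1)ᶜ = {y | 1 < ‖y‖} := by
    ext; simp
  have hc1 : Set.EqOn (fun y : ι → K => (max 1 ‖y‖) ^ (-γ)) (fun _ => 1) (closedBall 0 1) := by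
    intro y hy
    rw [mem_closedBall_zero_iff] at hy
    simp [max_eq_left hy]
  have hc2 : Set.EqOn (fun y : ι → K => (max 1 ‖y‖) ^ (-γ)) (fun y => ‖y‖ ^ (-γ))
      {y | 1 < ‖y‖} := by
    intro y hy
    have hy' : 1 < ‖y‖ := hy
    simp [max_eq_right hy'.le]
  have hms : MeasurableSet {y : ι → K | 1 < ‖y‖} := hcompl ▸ isClosed_closedBall.measurableSet.compl
  have hfin : haarPi K ι (closedBall 0 1) ≠ ⊤ := (isCompact_closedBall _ _).measure_lt_top.ne
  have h1 : IntegrableOn (fun y : ι → K => (max 1 ‖y‖) ^ (-γ)) (closedBall 0 1) (haarPi K ι) :=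
    (integrableOn_congr_fun hc1 isClosed_closedBall.measurableSet).2 (integrableOn_const hfin)
  have h2 : IntegrableOn (fun y : ι → K => (max 1 ‖y‖) ^ (-γ)) (closedBall 0 1)ᶜ
      (haarPi K ι) := by
    rw [hcompl]
    exact (integrableOn_congr_fun hc2 hms).2 hI
  have hint : Integrable (fun y : ι → K => (max 1 ‖y‖) ^ (-γ)) (haarPi K ι) := by
    rw [← integrableOn_univ, ← Set.union_compl_self (closedBall (0 : ι → K) 1)]
    exact h1.union h2
  rw [← integral_add_compl isClosed_closedBall.measurableSet hint, hcompl,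
    setIntegral_congr_fun isClosed_closedBall.measurableSet hc1, setIntegral_congr_fun hms hc2, hv,
    setIntegral_const, Measure.real, haarPi_closedBall_one]
  have : (1 - (q K : ℝ) ^ Fintype.card ι * (q K : ℝ) ^ (-γ)) ≠ 0 := by linarith
  simp only [ENNReal.toReal_one, smul_eq_mul, mul_one]
  rw [eq_div_iff this, add_mul, div_mul_cancel₀ _ this]
  ring

theorem integral_max_norm_rpow (hK : IsNormalizedNorm K) {γ : ℝ}
    (hγ : Fintype.card ι < γ) {z : K} (hz : z ≠ 0) :
    ∫ y : ι → K, (((max ‖z‖ ‖y‖) ^ (-γ) : ℝ) : ℂ) ∂(haarPi K ι) =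
      ((‖z‖ ^ Fintype.card ι * ‖z‖ ^ (-γ) * ((1 - (q K : ℝ) ^ (-γ)) /
        (1 - (q K : ℝ) ^ Fintype.card ι * (q K : ℝ) ^ (-γ))) : ℝ) : ℂ) := by
  rw [integral_comp_smul hK hz, ← integral_max_one_norm_rpow hK hγ]
  have : ∀ y : ι → K, (max ‖z‖ ‖z • y‖) ^ (-γ) = ‖z‖ ^ (-γ) * (max 1 ‖y‖) ^ (-γ) := by
    intro y
    rw [← Real.mul_rpow (norm_nonneg _) (by positivity), mul_max_of_nonneg _ _ (norm_nonneg z),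
      mul_one, norm_smul]
  simp only [this]
  rw [integral_complex_ofReal, integral_const_mul]
  push_cast
  ring

end Radial

section PlaneWave

variable {K : Type*} [NontriviallyNormedField K] [IsUltrametricDist K] [ProperSpace K]
  [MeasurableSpace K] [BorelSpace K]

theorem pi_norm_eq_max {K : Type*} [SeminormedAddCommGroup K] {m : ℕ} (z : Fin (m + 1) → K)
    (j : Fin (m + 1)) : ‖z‖ = max ‖z j‖ ‖fun i => z (j.succAbove i)‖ := by
  refine le_antisymm ((pi_norm_le_iff_of_nonneg (by positivity)).2 fun i => ?_)
    (max_le (norm_le_pi_norm z j) ((pi_norm_le_iff_of_nonneg (norm_nonneg _)).2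
      fun i => norm_le_pi_norm z _))
  obtain rfl | ⟨i, rfl⟩ := Fin.eq_self_or_eq_succAbove j i
  · exact le_max_left _ _
  · exact le_max_of_le_right (norm_le_pi_norm (fun i => z (j.succAbove i)) i)

/-- The image of the density `‖y‖ ^ (-α - n)` under a linear form of norm `1` is a multiple of
the density `|z| ^ (-α - 1)`. -/
theorem integral_norm_rpow_mul_dotProduct (hK : IsNormalizedNorm K) {m : ℕ} {α : ℝ} (hα : 0 < α)
    {u : Fin (m + 1) → K} (hu : ‖u‖ = 1) {G : K → ℂ} (hG : G 0 = 0)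
    (hI : Integrable (fun y : Fin (m + 1) → K =>
      ((‖y‖ ^ (-α - ((m + 1 : ℕ) : ℝ)) : ℝ) : ℂ) * G (u ⬝ᵥ y)) (haarPi K (Fin (m + 1)))) :
    ∫ y : Fin (m + 1) → K, ((‖y‖ ^ (-α - ((m + 1 : ℕ) : ℝ)) : ℝ) : ℂ) * G (u ⬝ᵥ y)
        ∂(haarPi K (Fin (m + 1))) =
      (((1 - (q K : ℝ) ^ (-α - ((m + 1 : ℕ) : ℝ))) / (1 - (q K : ℝ) ^ (-α - 1)) : ℝ) : ℂ) *
        ∫ z, ((‖z‖ ^ (-α - 1) : ℝ) : ℂ) * G z ∂(haar K) := by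
  have hq := one_lt_q hK
  obtain ⟨j, hj⟩ := exists_norm_eq_norm u
  rw [hu] at hj
  have hj0 : u j ≠ 0 := by rw [← norm_pos_iff, ← hj]; exact one_pos
  set γ : ℝ := α + ((m + 1 : ℕ) : ℝ) with hγ
  have hγ' : -α - ((m + 1 : ℕ) : ℝ) = -γ := by rw [hγ]; ring
  have hmγ : (Fintype.card (Fin m) : ℝ) < γ := by
    rw [hγ, Fintype.card_fin]; push_cast; linarith
  rw [hγ'] at hI ⊢
  have mp := measurePreserving_shearEquiv hu hj0 hj.symm
  have me : MeasurableEmbedding (shearEquiv u j hj0) :=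
    (shearEquiv u j hj0).toHomeomorph.measurableEmbedding
  let f : (Fin (m + 1) → K) → ℂ := fun z => ((‖z‖ ^ (-γ) : ℝ) : ℂ) * G (z j)
  have hf : (fun y : Fin (m + 1) → K => ((‖y‖ ^ (-γ) : ℝ) : ℂ) * G (u ⬝ᵥ y)) =
      fun y => f (shearEquiv u j hj0 y) := by
    ext y
    simp only [f]
    rw [norm_shearEquiv hu hj0 hj.symm, shearEquiv_apply, Function.update_self]
  rw [hf] at hI ⊢
  rw [mp.integral_comp me]
  have hIf : Integrable f (haarPi K (Fin (m + 1))) := (mp.integrable_comp_emb me).1 hI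
  have mp2 := measurePreserving_piFinSuccAbove (fun _ : Fin (m + 1) => haar K) j
  have me2 := (MeasurableEquiv.piFinSuccAbove (fun _ : Fin (m + 1) => K) j).measurableEmbedding
  let g : K × (Fin m → K) → ℂ := fun p => (((max ‖p.1‖ ‖p.2‖) ^ (-γ) : ℝ) : ℂ) * G p.1
  have hg : f = fun z => g (MeasurableEquiv.piFinSuccAbove (fun _ : Fin (m + 1) => K) j z) := by
    ext z
    simp only [f, g, pi_norm_eq_max z j]
    rfl
  rw [hg] at hIf ⊢
  rw [mp2.integral_comp me2]
  have hIg : Integrable g _ := (mp2.integrable_comp_emb me2).1 hIf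
  rw [integral_prod _ hIg, ← integral_const_mul]
  refine integral_congr_ae (Filter.Eventually.of_forall fun z => ?_)
  simp only [g]
  by_cases hz : z = 0
  · simp [hz, hG]
  have hz' := norm_pos_iff.2 hz
  rw [integral_mul_const, integral_max_norm_rpow hK hmγ hz, ← Real.rpow_natCast,
    ← Real.rpow_natCast, ← Real.rpow_add hz', ← Real.rpow_add (by positivity), Fintype.card_fin]
  have : (m : ℝ) + -γ = -α - 1 := by rw [hγ]; push_cast; ring
  rw [this]
  push_cast
  ring

end PlaneWave

/-! ### Hypersingular operators and superpositions of plane waves -/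

section Hypersingular

theorem IsLocConst.continuous {E : Type*} [NormedAddCommGroup E] {f : E → ℂ}
    (hf : IsLocConst f) : Continuous f := by
  obtain ⟨δ, hδ, h⟩ := hf
  refine continuous_iff_continuousAt.2 fun x => ?_
  refine (continuousAt_const (y := f x)).congr ?_
  filter_upwards [Metric.closedBall_mem_nhds x hδ] with y hy
  rw [mem_closedBall, dist_eq_norm] at hy
  simpa using (h x (y - x) hy).symm

variable {E S : Type*} [NormedAddCommGroup E] [MeasurableSpace E] [BorelSpace E]
  [SecondCountableTopology E] {μ : Measure E} [MeasurableSpace S] {ν : Measure S}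
  [IsFiniteMeasure ν] {w : E → ℝ} {δ C : ℝ}

theorem measurableSet_lt_norm {E : Type*} [NormedAddCommGroup E] [MeasurableSpace E]
    [BorelSpace E] (δ : ℝ) : MeasurableSet {y : E | δ < ‖y‖} :=
  (isOpen_lt continuous_const continuous_norm).measurableSet

/-- Joint integrability of a hypersingular integrand that depends on a parameter. The singularity
of the weight at `0` is invisible, as the difference vanishes for `‖y‖ ≤ δ`. -/
theorem integrable_hypersingular_prod (hwm : Measurable w)
    (hw : IntegrableOn w {y | δ < ‖y‖} μ) {G : S → E → ℂ} (hG : Measurable (Function.uncurry G))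
    (hC : ∀ s x, ‖G s x‖ ≤ C)
    (hδ : ∀ᵐ s ∂ν, ∀ x x', ‖x'‖ ≤ δ → G s (x + x') = G s x) (x : E) :
    Integrable (fun p : E × S => (w p.1 : ℂ) * (G p.2 (x - p.1) - G p.2 x)) (μ.prod ν) := by
  have hbound : Integrable (fun p : E × S => {y | δ < ‖y‖}.indicator (fun y => ‖w y‖) p.1 *
      (C + C)) (μ.prod ν) :=
    ((integrable_indicator_iff (measurableSet_lt_norm δ)).2 hw.norm).mul_prod
      (integrable_const (C + C))
  refine hbound.mono' ?_ ?_
  · have h1 : Measurable fun p : E × S => G p.2 (x - p.1) :=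
      hG.comp (measurable_snd.prodMk (measurable_const.sub measurable_fst))
    have h2 : Measurable fun p : E × S => G p.2 x :=
      hG.comp (measurable_snd.prodMk measurable_const)
    have h3 : Measurable fun p : E × S => (w p.1 : ℂ) :=
      Complex.measurable_ofReal.comp (hwm.comp measurable_fst)
    exact (h3.mul (h1.sub h2)).aestronglyMeasurable
  · have hae := (Measure.quasiMeasurePreserving_snd (μ := μ) (ν := ν)).ae hδ
    filter_upwards [hae] with p hp
    by_cases h : δ < ‖p.1‖
    · rw [Set.indicator_of_mem (show p.1 ∈ {y : E | δ < ‖y‖} from h), norm_mul,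
        Complex.norm_real]
      exact mul_le_mul_of_nonneg_left
        ((norm_sub_le _ _).trans (add_le_add (hC _ _) (hC _ _))) (norm_nonneg _)
    · have h0 : G p.2 (x - p.1) = G p.2 x := by
        rw [sub_eq_add_neg]
        exact hp x (-p.1) (by rw [norm_neg]; exact not_lt.1 h)
      rw [Set.indicator_of_notMem (show p.1 ∉ {y : E | δ < ‖y‖} from h), h0]
      simp

theorem integrable_hypersingular (hwm : Measurable w) (hw : IntegrableOn w {y | δ < ‖y‖} μ)
    {g : E → ℂ} (hg : Measurable g) (hC : ∀ x, ‖g x‖ ≤ C)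
    (hδ : ∀ x x', ‖x'‖ ≤ δ → g (x + x') = g x) (x : E) :
    Integrable (fun y => (w y : ℂ) * (g (x - y) - g x)) μ := by
  have h := integrable_hypersingular_prod (ν := Measure.dirac ()) hwm hw (G := fun _ => g)
    (hg.comp measurable_snd) (fun _ => hC) (Filter.Eventually.of_forall fun _ => hδ) x
  have h2 := h.integral_prod_left
  simpa using h2

/-- A hypersingular operator commutes with the integration over a parameter. -/
theorem integral_hypersingular_swap (hwm : Measurable w)
    (hw : IntegrableOn w {y | δ < ‖y‖} μ) {G : S → E → ℂ} (hG : Measurable (Function.uncurry G))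
    (hC : ∀ s x, ‖G s x‖ ≤ C)
    (hδ : ∀ᵐ s ∂ν, ∀ x x', ‖x'‖ ≤ δ → G s (x + x') = G s x) [SFinite μ] (x : E) :
    ∫ y, (w y : ℂ) * (∫ s, G s (x - y) ∂ν - ∫ s, G s x ∂ν) ∂μ =
      ∫ s, ∫ y, (w y : ℂ) * (G s (x - y) - G s x) ∂μ ∂ν := by
  rw [← integral_integral_swap (integrable_hypersingular_prod hwm hw hG hC hδ x)]
  refine integral_congr_ae (Filter.Eventually.of_forall fun y => ?_)
  have hint : ∀ z, Integrable (fun s => G s z) ν := fun z =>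
    Integrable.of_bound
      (hG.comp (measurable_id.prodMk measurable_const)).aestronglyMeasurable C
      (Filter.Eventually.of_forall fun s => hC s z)
  simp only
  rw [integral_const_mul, integral_sub (hint _) (hint _)]

end Hypersingular

section Operators

theorem isLocConst_planeWave {K : Type*} [NontriviallyNormedField K] [IsUltrametricDist K]
    {n : ℕ} {u : Fin n → K} (hu : ‖u‖ ≤ 1) {g : K → ℂ}
    (hg : IsLocConst g) (t : K) : IsLocConst fun x : Fin n → K => g (t + u ⬝ᵥ x) := by
  obtain ⟨δ, hδ, hc⟩ := hg
  refine ⟨δ, hδ, fun x x' hx' => ?_⟩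
  simp only [dotProduct_add, ← add_assoc]
  refine hc _ _ ((norm_dotProduct_le u x').trans ?_)
  exact (mul_le_of_le_one_left (norm_nonneg _) hu).trans hx'

variable {K : Type*} [NontriviallyNormedField K] [IsUltrametricDist K] [ProperSpace K]
  [MeasurableSpace K] [BorelSpace K]

theorem measurable_norm_rpow {E : Type*} [NormedAddCommGroup E] [MeasurableSpace E]
    [BorelSpace E] (γ : ℝ) : Measurable fun y : E => ‖y‖ ^ γ :=
  measurable_norm.pow_const γ

theorem integrableOn_weight (hK : IsNormalizedNorm K) {α : ℝ} (hα : 0 < α) {δ : ℝ}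
    (hδ : 0 < δ) : IntegrableOn (fun y : K => ‖y‖ ^ (-α - 1)) {y | δ < ‖y‖} (haar K) := by
  have := integrableOn_haar_norm_rpow hK (γ := α + 1) (by linarith) hδ
  simpa only [neg_add'] using this

theorem integrableOn_weightN (hK : IsNormalizedNorm K) {n : ℕ} {α : ℝ} (hα : 0 < α) {δ : ℝ}
    (hδ : 0 < δ) :
    IntegrableOn (fun y : Fin n → K => ‖y‖ ^ (-α - (n : ℝ))) {y | δ < ‖y‖}
      (haarPi K (Fin n)) := by
  have := integrableOn_norm_rpow (ι := Fin n) hK (γ := α + n)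
    (by rw [Fintype.card_fin]; linarith) hδ
  simpa only [neg_add'] using this

theorem fracDExists_of_isLocConst (hK : IsNormalizedNorm K) {α : ℝ} (hα : 0 ≤ α) {g : K → ℂ}
    (hg : IsLocConst g) {C : ℝ} (hC : ∀ s, ‖g s‖ ≤ C) (s : K) : FracDExists α g s := by
  rcases hα.eq_or_lt with h | h
  · exact Or.inl h.symm
  · obtain ⟨δ, hδ, hc⟩ := id hg
    exact Or.inr (integrable_hypersingular (measurable_norm_rpow _)
      (integrableOn_weight hK h hδ) hg.continuous.measurable hC hc s)

theorem fracDNExists_of_isLocConst (hK : IsNormalizedNorm K) {n : ℕ} {α : ℝ} (hα : 0 < α)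
    {g : (Fin n → K) → ℂ} (hg : IsLocConst g) {C : ℝ} (hC : ∀ s, ‖g s‖ ≤ C) (x : Fin n → K) :
    FracDNExists α g x := by
  obtain ⟨δ, hδ, hc⟩ := id hg
  exact integrable_hypersingular (measurable_norm_rpow _)
    (integrableOn_weightN hK hα hδ) hg.continuous.measurable hC hc x

theorem fracD_comp_add_right (α : ℝ) (g : K → ℂ) (c s : K) :
    fracD α (fun r => g (r + c)) s = fracD α g (s + c) := by
  simp only [fracD, fracIntegrand, sub_add_eq_add_sub]

/-- A plane wave `g (t + u · x)` with `‖u‖ = 1` solves the wave equation: `D^{α,n}` in `x` acts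
on it as `D^α` acts on the profile `g`. -/
theorem fracDN_planeWave (hK : IsNormalizedNorm K) {m : ℕ} {α : ℝ} (hα : 0 < α)
    {u : Fin (m + 1) → K} (hu : ‖u‖ = 1) {g : K → ℂ} (hg : IsLocConst g) {C : ℝ}
    (hC : ∀ s, ‖g s‖ ≤ C) (t : K) (x : Fin (m + 1) → K) :
    fracDN α (fun x => g (t + u ⬝ᵥ x)) x = fracD α g (t + u ⬝ᵥ x) := by
  have hq := one_lt_q hK
  have hEx := fracDNExists_of_isLocConst hK hα (isLocConst_planeWave hu.le hg t)
    (fun x => hC (t + u ⬝ᵥ x)) x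
  have hI : fracIntegrandN α (fun x => g (t + u ⬝ᵥ x)) x = fun y : Fin (m + 1) → K =>
      ((‖y‖ ^ (-α - ((m + 1 : ℕ) : ℝ)) : ℝ) : ℂ) *
        (fun z => g (t + u ⬝ᵥ x - z) - g (t + u ⬝ᵥ x)) (u ⬝ᵥ y) := by
    ext y
    simp only [fracIntegrandN, dotProduct_sub, add_sub_assoc]
  rw [FracDNExists, hI] at hEx
  rw [fracDN, hI, integral_norm_rpow_mul_dotProduct hK hα hu
    (G := fun z => g (t + u ⬝ᵥ x - z) - g (t + u ⬝ᵥ x)) (by simp) hEx, fracD, if_neg hα.ne',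
    ← mul_assoc, ← Complex.ofReal_mul]
  have : (q K : ℝ) ^ (-α - ((m + 1 : ℕ) : ℝ)) < 1 :=
    Real.rpow_lt_one_of_one_lt_of_neg hq (by push_cast; linarith [(m.cast_nonneg : (0 : ℝ) ≤ m)])
  rw [div_mul_div_cancel₀ (by linarith)]
  rfl

end Operators

section SphereMean

variable {K : Type*} [NontriviallyNormedField K] [IsUltrametricDist K] [ProperSpace K]
  [MeasurableSpace K] [BorelSpace K] {n : ℕ}

/-- A measurable family, indexed by the directions `u`, of wave profiles `G u : K → ℂ` that are
bounded and locally constant uniformly in `u`, and equivariant under the units of `K`. -/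
structure IsProfileFamily (G : (Fin n → K) → K → ℂ) : Prop where
  measurable : Measurable (Function.uncurry G)
  bounded : ∃ C : ℝ, ∀ u s, ‖G u s‖ ≤ C
  locConst : ∃ δ : ℝ, 0 < δ ∧ ∀ u s s', ‖s'‖ ≤ δ → G u (s + s') = G u s
  smul_mul : ∀ (ε : K) (u : Fin n → K) (s : K), ‖ε‖ = 1 → G (ε • u) (ε * s) = G u s

/-- The superposition of the plane waves `G u (t + u · x)` over the directions `‖u‖ = 1`. -/
noncomputable def sphereMean (G : (Fin n → K) → K → ℂ) (t : K) (x : Fin n → K) : ℂ :=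
  ∫ u in sphere (0 : Fin n → K) 1, G u (t + u ⬝ᵥ x) ∂(haarPi K (Fin n))

theorem isFiniteMeasure_restrict_sphere :
    IsFiniteMeasure ((haarPi K (Fin n)).restrict (sphere 0 1)) :=
  isFiniteMeasure_restrict.2 (isCompact_sphere _ _).measure_lt_top.ne

theorem ae_restrict_sphere {p : (Fin n → K) → Prop} (h : ∀ u, ‖u‖ = 1 → p u) :
    ∀ᵐ u ∂((haarPi K (Fin n)).restrict (sphere 0 1)), p u :=
  (ae_restrict_iff' isClosed_sphere.measurableSet).2
    (Filter.Eventually.of_forall fun u hu => h u (mem_sphere_zero_iff_norm.1 hu))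

theorem IsProfileFamily.isLocConst {K : Type*} [NontriviallyNormedField K] [MeasurableSpace K]
    {n : ℕ} {G : (Fin n → K) → K → ℂ} (hG : IsProfileFamily G) (u : Fin n → K) :
    IsLocConst (G u) := by
  obtain ⟨δ, hδ, h⟩ := hG.locConst
  exact ⟨δ, hδ, h u⟩

theorem IsProfileFamily.measurable_shift {K : Type*} [NontriviallyNormedField K] [ProperSpace K]
    [MeasurableSpace K] [BorelSpace K] {n : ℕ} {G : (Fin n → K) → K → ℂ}
    (hG : IsProfileFamily G) (x : Fin n → K) :
    Measurable (Function.uncurry fun (u : Fin n → K) (s : K) => G u (s + u ⬝ᵥ x)) := by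
  have hd : Continuous fun p : (Fin n → K) × K => p.2 + p.1 ⬝ᵥ x := by
    simp only [dotProduct]; fun_prop
  exact hG.measurable.comp (measurable_fst.prodMk hd.measurable)

theorem norm_sphereMean_le {G : (Fin n → K) → K → ℂ} {C : ℝ} (hC : ∀ u s, ‖G u s‖ ≤ C)
    (t : K) (x : Fin n → K) : ‖sphereMean G t x‖ ≤ C * (haarPi K (Fin n)).real (sphere 0 1) :=
  norm_setIntegral_le_of_norm_le_const (isCompact_sphere _ _).measure_lt_top fun u _ => hC u _

namespace IsProfileFamily

variable {G : (Fin n → K) → K → ℂ}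

theorem integrableOn (hG : IsProfileFamily G) (t : K) (x : Fin n → K) :
    IntegrableOn (fun u => G u (t + u ⬝ᵥ x)) (sphere 0 1) (haarPi K (Fin n)) := by
  have := isFiniteMeasure_restrict_sphere (K := K) (n := n)
  obtain ⟨C, hC⟩ := hG.bounded
  have hd : Continuous fun u : Fin n → K => t + u ⬝ᵥ x := by
    simp only [dotProduct]; fun_prop
  exact Integrable.of_bound
    (hG.measurable.comp (measurable_id.prodMk hd.measurable)).aestronglyMeasurable C
    (Filter.Eventually.of_forall fun u => hC u _)

theorem isLocConst_sphereMean (hG : IsProfileFamily G) :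
    IsLocConst fun p : K × (Fin n → K) => sphereMean G p.1 p.2 := by
  obtain ⟨δ, hδ, h⟩ := hG.locConst
  refine ⟨δ, hδ, fun p p' hp => ?_⟩
  refine setIntegral_congr_fun isClosed_sphere.measurableSet fun u hu => ?_
  rw [mem_sphere_zero_iff_norm] at hu
  have h1 : p.1 + p'.1 + u ⬝ᵥ (p.2 + p'.2) = p.1 + u ⬝ᵥ p.2 + (p'.1 + u ⬝ᵥ p'.2) := by
    rw [dotProduct_add]; ring
  simp only [Prod.fst_add, Prod.snd_add]
  rw [h1]
  refine h _ _ _ ((IsUltrametricDist.norm_add_le_max _ _).trans (max_le ?_ ?_))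
  · exact (norm_fst_le p').trans hp
  · refine (norm_dotProduct_le u p'.2).trans ?_
    rw [hu, one_mul]
    exact (norm_snd_le p').trans hp

/-- Two times of the same absolute value differ by a unit, which the substitution `u ↦ ε u` on
the sphere absorbs. -/
theorem isRadialInTime_sphereMean (hG : IsProfileFamily G) : IsRadialInTime (sphereMean G) := by
  intro t t' x htt
  by_cases ht : t = 0
  · subst ht
    rw [norm_zero, eq_comm, norm_eq_zero] at htt
    rw [htt]
  have hε : ‖t' / t‖ = 1 := by rw [norm_div, ← htt, div_self (norm_ne_zero_iff.2 ht)]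
  set ε := t' / t
  have hε0 : ε ≠ 0 := by rw [← norm_pos_iff, hε]; exact one_pos
  have ht' : t' = ε * t := (div_mul_cancel₀ t' ht).symm
  have mp := measurePreserving_of_norm_eq (smulEquiv (Fin n → K) ε hε0)
    (fun x => by rw [smulEquiv_apply, norm_smul, hε, one_mul])
  have h := mp.setIntegral_preimage_emb
    (smulEquiv (Fin n → K) ε hε0).toHomeomorph.measurableEmbedding
    (fun u => G u (t' + u ⬝ᵥ x)) (sphere 0 1)
  have hpre : smulEquiv (Fin n → K) ε hε0 ⁻¹' sphere 0 1 = sphere 0 1 := by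
    ext u
    simp [norm_smul, hε]
  rw [sphereMean, sphereMean, ← h, hpre]
  congr 1
  ext u
  rw [smulEquiv_apply, smul_dotProduct, smul_eq_mul, ht', ← mul_add, hG.smul_mul _ _ _ hε]

theorem fracD_sphereMean (hG : IsProfileFamily G) (hK : IsNormalizedNorm K) {α : ℝ}
    (hα : 0 ≤ α) (t : K) (x : Fin n → K) :
    fracD α (fun s => sphereMean G s x) t = sphereMean (fun u => fracD α (G u)) t x := by
  have := isFiniteMeasure_restrict_sphere (K := K) (n := n)
  rcases hα.eq_or_lt with h | h
  · simp only [sphereMean, fracD, if_pos h.symm]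
  obtain ⟨C, hC⟩ := hG.bounded
  obtain ⟨δ, hδ, hc⟩ := hG.locConst
  have hsw := integral_hypersingular_swap (measurable_norm_rpow _) (integrableOn_weight hK h hδ)
    (ν := (haarPi K (Fin n)).restrict (sphere 0 1)) (hG.measurable_shift x) (fun u s => hC u _)
    (ae_restrict_sphere fun u _ s s' hs' => by rw [add_right_comm]; exact hc u _ _ hs') t
  simp only [sphereMean, ← fracD_comp_add_right]
  simp only [fracD, if_neg h.ne', integral_const_mul]
  congr 1

theorem fracDN_sphereMean (hG : IsProfileFamily G) (hK : IsNormalizedNorm K) {α : ℝ}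
    (hα : 0 < α) (t : K) (x : Fin n → K) :
    fracDN α (sphereMean G t) x = ∫ u in sphere (0 : Fin n → K) 1,
      fracDN α (fun x => G u (t + u ⬝ᵥ x)) x ∂(haarPi K (Fin n)) := by
  have := isFiniteMeasure_restrict_sphere (K := K) (n := n)
  obtain ⟨C, hC⟩ := hG.bounded
  obtain ⟨δ, hδ, hc⟩ := hG.locConst
  have hd : Continuous fun p : (Fin n → K) × (Fin n → K) => t + p.1 ⬝ᵥ p.2 := by
    simp only [dotProduct]; fun_prop
  have hm : Measurable (Function.uncurry fun (u x : Fin n → K) => G u (t + u ⬝ᵥ x)) :=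
    hG.measurable.comp (measurable_fst.prodMk hd.measurable)
  have hsw := integral_hypersingular_swap (measurable_norm_rpow _)
    (integrableOn_weightN hK hα hδ)
    (ν := (haarPi K (Fin n)).restrict (sphere 0 1)) hm (fun u s => hC u _)
    (ae_restrict_sphere fun u hu z z' hz' => by
      rw [dotProduct_add, ← add_assoc]
      refine hc u _ _ ((norm_dotProduct_le u z').trans ?_)
      rwa [hu, one_mul]) x
  simp only [fracDN, integral_const_mul]
  congr 1

/-- Superpositions of plane waves are classical solutions. -/
theorem isClassicalSolution (hG : IsProfileFamily G) (hK : IsNormalizedNorm K) (hn : 1 ≤ n) :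
    IsClassicalSolution (sphereMean G) := by
  obtain ⟨C, hC⟩ := hG.bounded
  obtain ⟨δ, hδ, hc⟩ := hG.isLocConst_sphereMean
  refine ⟨hG.isRadialInTime_sphereMean, ⟨δ, hδ, hc⟩, ⟨_, norm_sphereMean_le hC⟩, ?_⟩
  intro α hα t x
  refine ⟨?_, ?_, ?_⟩
  · refine fracDExists_of_isLocConst hK hα.le ⟨δ, hδ, fun s s' hs' => ?_⟩
      (fun s => norm_sphereMean_le hC s x) t
    simpa using hc (s, x) (s', 0) (by simp [Prod.norm_def, hs'])
  · refine fracDNExists_of_isLocConst hK hα ⟨δ, hδ, fun y y' hy' => ?_⟩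
      (fun y => norm_sphereMean_le hC t y) x
    simpa using hc (t, y) (0, y') (by simp [Prod.norm_def, hy'])
  · obtain ⟨m, rfl⟩ : ∃ m, n = m + 1 := ⟨n - 1, by omega⟩
    rw [hG.fracD_sphereMean hK hα.le, hG.fracDN_sphereMean hK hα, sub_eq_zero]
    refine setIntegral_congr_fun isClosed_sphere.measurableSet fun u hu => ?_
    exact (fracDN_planeWave hK hα (mem_sphere_zero_iff_norm.1 hu) (hG.isLocConst u) (hC u)
      t x).symm

end IsProfileFamily

end SphereMean

/-! ### Indicators of balls and their Radon transforms -/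

section BallIndicator

variable {E : Type*} [NormedAddCommGroup E]

/-- The indicator function of the ball of radius `r` centred at `0`. -/
noncomputable def ballIndicator (r : ℝ) (x : E) : ℂ := if ‖x‖ ≤ r then 1 else 0

theorem ballIndicator_eq_indicator (r : ℝ) (a x : E) :
    ballIndicator r (x - a) = (closedBall a r).indicator 1 x := by
  by_cases h : ‖x - a‖ ≤ r
  · rw [Set.indicator_of_mem (by rwa [mem_closedBall, dist_eq_norm]), ballIndicator, if_pos h,
      Pi.one_apply]
  · rw [Set.indicator_of_notMem (by rwa [mem_closedBall, dist_eq_norm]), ballIndicator, if_neg h]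

theorem ballIndicator_add [IsUltrametricDist E] {r : ℝ} (x : E) {y : E} (hy : ‖y‖ ≤ r) :
    ballIndicator r (x + y) = ballIndicator r x := by
  have h : ‖x + y‖ ≤ r ↔ ‖x‖ ≤ r := by
    refine ⟨fun h => ?_, fun h => (IsUltrametricDist.norm_add_le_max _ _).trans (max_le h hy)⟩
    have := IsUltrametricDist.norm_add_le_max (x + y) (-y)
    rw [add_neg_cancel_right, norm_neg] at this
    exact this.trans (max_le h hy)
  simp only [ballIndicator, h]

theorem norm_ballIndicator_le (r : ℝ) (x : E) : ‖ballIndicator r x‖ ≤ 1 := by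
  unfold ballIndicator
  split_ifs <;> simp

theorem exists_eq_sum_ballIndicator_of_support [IsUltrametricDist E] {r : ℝ}
    (A : Finset E) (φ : E → ℂ) (hφ : ∀ x y, ‖y‖ ≤ r → φ (x + y) = φ x)
    (hA : ∀ x, φ x ≠ 0 → ∃ a ∈ A, ‖x - a‖ ≤ r) :
    ∃ c : E → ℂ, ∀ x, φ x = ∑ a ∈ A, c a * ballIndicator r (x - a) := by
  classical
  induction A using Finset.induction_on generalizing φ with
  | empty =>
    refine ⟨0, fun x => ?_⟩
    by_contra h
    simpa using hA x (by simpa using h)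
  | insert a A ha ih =>
    -- remove from `φ` its part on the ball around `a`
    obtain ⟨c, hc⟩ := ih (fun x => φ x - φ a * ballIndicator r (x - a))
      (fun x y hy => by
        rw [hφ x y hy, add_sub_right_comm, ballIndicator_add _ hy])
      (fun x hx => by
        by_cases h : ‖x - a‖ ≤ r
        · refine absurd ?_ hx
          have := hφ a (x - a) h
          rw [add_sub_cancel] at this
          simp [this, ballIndicator, h]
        · simp only [ballIndicator, if_neg h, mul_zero, sub_zero] at hx
          obtain ⟨b, hb, hxb⟩ := hA x hx
          rcases Finset.mem_insert.1 hb with rfl | hb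
          · exact absurd hxb h
          · exact ⟨b, hb, hxb⟩)
    refine ⟨Function.update c a (φ a), fun x => ?_⟩
    rw [Finset.sum_insert ha, Function.update_self, ← sub_eq_iff_eq_add', hc x]
    refine Finset.sum_congr rfl fun b hb => ?_
    rw [Function.update_of_ne]
    rintro rfl
    exact ha hb

/-- A test function is a linear combination of indicators of balls of any sufficiently small
common radius. -/
theorem IsTestFunction.exists_eq_sum_ballIndicator [IsUltrametricDist E] {φ : E → ℂ}
    (hφ : IsTestFunction φ) : ∃ δ : ℝ, 0 < δ ∧ ∀ r, 0 < r → r ≤ δ → ∃ (A : Finset E) (c : E → ℂ),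
      ∀ x, φ x = ∑ a ∈ A, c a * ballIndicator r (x - a) := by
  obtain ⟨⟨δ, hδ, h⟩, hsupp⟩ := hφ
  refine ⟨δ, hδ, fun r hr hrδ => ?_⟩
  obtain ⟨A, -, hA⟩ := hsupp.elim_nhds_subcover (fun x => closedBall x r)
    (fun x _ => closedBall_mem_nhds x hr)
  refine ⟨A, exists_eq_sum_ballIndicator_of_support A φ
    (fun x y hy => h x y (hy.trans hrδ)) fun x hx => ?_⟩
  have := hA (subset_tsupport φ hx)
  simpa [dist_eq_norm] using this

end BallIndicator

section CharacterIntegral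

theorem integral_indicator_one_complex {X : Type*} [MeasurableSpace X] {μ : Measure X}
    {s : Set X} (hs : MeasurableSet s) :
    ∫ x, s.indicator (1 : X → ℂ) x ∂μ = (μ.real s : ℂ) := by
  rw [show (1 : X → ℂ) = fun _ => 1 from rfl, integral_indicator_const _ hs]
  simp

variable {K : Type*} [NontriviallyNormedField K] [IsUltrametricDist K] [ProperSpace K]
  [MeasurableSpace K] [BorelSpace K] {ι : Type*} [Fintype ι]

/-- Orthogonality: the integral of a character over a ball is the volume of the ball if the
character is trivial there, and `0` otherwise. -/
theorem integral_character_ballIndicator (hK : IsNormalizedNorm K) {χ : AddChar K Circle}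
    (hχ : IsRankZero K χ) (b : K) (ξ : ι → K) :
    ∫ x : ι → K, (χ (x ⬝ᵥ ξ) : ℂ) * ballIndicator ‖b‖ x ∂(haarPi K ι) =
      if ‖ξ‖ * ‖b‖ ≤ 1 then (‖b‖ : ℂ) ^ Fintype.card ι else 0 := by
  classical
  split_ifs with h
  · have : (fun x : ι → K => (χ (x ⬝ᵥ ξ) : ℂ) * ballIndicator ‖b‖ x) =
        (closedBall 0 ‖b‖).indicator 1 := by
      ext x
      rw [← sub_zero x, ballIndicator_eq_indicator, sub_zero]
      by_cases hx : x ∈ closedBall 0 ‖b‖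
      · rw [mem_closedBall_zero_iff] at hx
        have : ‖x ⬝ᵥ ξ‖ ≤ 1 := (norm_dotProduct_le x ξ).trans
          ((mul_le_mul_of_nonneg_right hx (norm_nonneg _)).trans (by rwa [mul_comm]))
        simp [hχ.eq_one _ this]
      · simp [Set.indicator_of_notMem hx]
    rw [this, integral_indicator_one_complex isClosed_closedBall.measurableSet,
      haarPi_real_closedBall hK]
    push_cast
    rfl
  · have hne : Nonempty ι := by
      by_contra h0
      rw [not_nonempty_iff] at h0
      rw [Subsingleton.elim ξ 0, norm_zero, zero_mul] at h
      exact h zero_le_one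
    obtain ⟨j, hj⟩ := exists_norm_eq_norm ξ
    obtain ⟨w, hw, hw1⟩ := hχ.ne_one
    have hξ0 : 0 < ‖ξ j‖ := by
      by_contra! h0
      rw [hj, le_antisymm h0 (norm_nonneg _), zero_mul] at h
      exact h zero_le_one
    -- a point `x₀` of the ball at which the character is not trivial
    have hx0 : ‖(Pi.single j (w / ξ j) : ι → K)‖ ≤ ‖b‖ := by
      rw [Pi.norm_single, norm_div, hw, div_le_iff₀ hξ0]
      by_contra! h0
      refine h ?_
      have := norm_le_of_norm_lt hK (x := b * ξ j) (a := 1) (by rw [norm_mul]; simpa using h0)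
      rwa [norm_mul, norm_one, ← hj, mul_comm] at this
    set x₀ : ι → K := Pi.single j (w / ξ j) with hx₀
    have hd : x₀ ⬝ᵥ ξ = w := by
      rw [hx₀, single_dotProduct, div_mul_cancel₀ _ (norm_pos_iff.1 hξ0)]
    have hinv := integral_add_right_eq_self (μ := haarPi K ι)
      (fun x : ι → K => (χ (x ⬝ᵥ ξ) : ℂ) * ballIndicator ‖b‖ x) x₀
    simp only [ballIndicator_add _ hx0, add_dotProduct, hd, AddChar.map_add_eq_mul,
      Circle.coe_mul, mul_assoc, mul_left_comm _ (χ w : ℂ)] at hinv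
    rw [integral_const_mul] at hinv
    have hne1 : (χ w : ℂ) ≠ 1 := by
      intro h1
      exact hw1 (Circle.ext h1)
    by_contra hI
    exact hne1 (mul_eq_right₀ hI |>.1 hinv)

theorem integral_haar_character_ballIndicator (hK : IsNormalizedNorm K) {χ : AddChar K Circle}
    (hχ : IsRankZero K χ) (b ξ : K) :
    ∫ x, (χ (x * ξ) : ℂ) * ballIndicator ‖b‖ x ∂(haar K) =
      if ‖ξ‖ * ‖b‖ ≤ 1 then (‖b‖ : ℂ) else 0 := by
  have h := integral_character_ballIndicator (ι := Unit) hK hχ b (fun _ => ξ)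
  rw [integral_haar_eq_haarPi]
  have hnorm : ∀ y : Unit → K, ‖y‖ = ‖y ()‖ := fun y => (exists_norm_eq_norm y).choose_spec
  simp only [Fintype.card_unit, pow_one, hnorm, ballIndicator, dotProduct, Finset.univ_unique,
    Finset.sum_singleton] at h
  exact h

/-- The Fourier transform of the indicator of a ball. -/
theorem fourier_ballIndicator (hK : IsNormalizedNorm K) {χ : AddChar K Circle}
    (hχ : IsRankZero K χ) (b : K) {n : ℕ} (a ξ : Fin n → K) :
    ∫ x : Fin n → K, (χ (x ⬝ᵥ ξ) : ℂ) * ballIndicator ‖b‖ (x - a) ∂(haarPi K (Fin n)) =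
      (χ (a ⬝ᵥ ξ) : ℂ) * if ‖ξ‖ * ‖b‖ ≤ 1 then (‖b‖ : ℂ) ^ n else 0 := by
  have h := integral_character_ballIndicator hK hχ b ξ
  rw [Fintype.card_fin] at h
  rw [← h, ← integral_const_mul, ← integral_add_right_eq_self _ a]
  congr 1
  ext x
  rw [add_sub_cancel_right, add_dotProduct, AddChar.map_add_eq_mul, Circle.coe_mul]
  ring

end CharacterIntegral

section Hyperplane

theorem dotProduct_eq_add_sum_ne {K : Type*} [CommRing K] {n : ℕ} (u x : Fin n → K) (j : Fin n) :
    u ⬝ᵥ x = u j * x j + (fun k : {i : Fin n // i ≠ j} => u k) ⬝ᵥ (fun k => x k) :=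
  Fintype.sum_eq_add_sum_subtype_ne (fun i => u i * x i) j

theorem continuous_hyperplanePoint {K : Type*} [NontriviallyNormedField K] [IsUltrametricDist K]
    {n : ℕ} (u : Fin n → K) (s : K) (j : Fin n) :
    Continuous (hyperplanePoint u s j) := by
  refine continuous_pi fun i => ?_
  by_cases h : i = j
  · simp only [hyperplanePoint, h, dif_pos]
    fun_prop
  · simp only [hyperplanePoint, dif_neg h]
    fun_prop

theorem hyperplanePoint_preimage_closedBall {K : Type*} [NontriviallyNormedField K] {n : ℕ}
    (u : Fin n → K) (s : K) {j : Fin n} (hj : u j ≠ 0)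
    (a : Fin n → K) (b : K) :
    (fun y => y + fun k : {i : Fin n // i ≠ j} => a k) ⁻¹'
        (hyperplanePoint u s j ⁻¹' closedBall a ‖b‖) =
      {y | ‖y‖ ≤ ‖b‖ ∧
        ‖(s - u ⬝ᵥ a) - (fun k : {i : Fin n // i ≠ j} => u k) ⬝ᵥ y‖ ≤ ‖b * u j‖} := by
  ext y
  simp only [Set.mem_preimage, Set.mem_ofPred_eq, mem_closedBall, dist_eq_norm]
  have key : hyperplanePoint u s j (y + fun k : {i : Fin n // i ≠ j} => a k) j - a j =
      (s - u ⬝ᵥ a - (fun k : {i : Fin n // i ≠ j} => u k) ⬝ᵥ y) / u j := by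
    simp only [hyperplanePoint, dif_pos]
    change (s - (fun k : {i : Fin n // i ≠ j} => u k) ⬝ᵥ
      (y + fun k : {i : Fin n // i ≠ j} => a k)) / u j - a j = _
    rw [dotProduct_add, dotProduct_eq_add_sum_ne u a j]
    field_simp
    ring
  have hne : ∀ k : {i : Fin n // i ≠ j},
      hyperplanePoint u s j (y + fun k : {i : Fin n // i ≠ j} => a k) k - a k = y k := by
    intro k
    simp [hyperplanePoint, k.2]
  rw [pi_norm_le_iff_of_nonneg (norm_nonneg _), pi_norm_le_iff_of_nonneg (norm_nonneg _)]
  have hkey2 : ‖(s - u ⬝ᵥ a - (fun k : {i : Fin n // i ≠ j} => u k) ⬝ᵥ y) / u j‖ ≤ ‖b‖ ↔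
      ‖(s - u ⬝ᵥ a) - (fun k : {i : Fin n // i ≠ j} => u k) ⬝ᵥ y‖ ≤ ‖b * u j‖ := by
    rw [norm_div, norm_mul, div_le_iff₀ (norm_pos_iff.2 hj)]
  rw [← hkey2, ← key]
  constructor
  · intro h
    exact ⟨fun k => by rw [← hne k]; exact h k, h j⟩
  · rintro ⟨h1, h2⟩ i
    by_cases hi : i = j
    · rw [hi]; exact h2
    · have := h1 ⟨i, hi⟩
      rw [← hne] at this
      exact this

variable {K : Type*} [NontriviallyNormedField K] [IsUltrametricDist K] [ProperSpace K]
  [MeasurableSpace K] [BorelSpace K] {ι : Type*} [Fintype ι]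

/-- The volume of the part of a ball on which a linear form is close to `s`. In the application
to a hyperplane, `c` is the coefficient of the eliminated coordinate and `u` collects the others;
the coefficient of norm `1` may be among either. -/
theorem haarPi_slab (hK : IsNormalizedNorm K) (u : ι → K) {b c : K} (hc : ‖c‖ ≤ 1)
    (hu : ‖u‖ ≤ 1) (huc : ‖c‖ = 1 ∨ ‖u‖ = 1) (s : K) :
    haarPi K ι {y | ‖y‖ ≤ ‖b‖ ∧ ‖s - u ⬝ᵥ y‖ ≤ ‖b * c‖} =
      if ‖s‖ ≤ ‖b‖ then ENNReal.ofReal (‖b‖ ^ Fintype.card ι * ‖c‖) else 0 := by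
  classical
  have hdot : ∀ y : ι → K, ‖y‖ ≤ ‖b‖ → ‖u ⬝ᵥ y‖ ≤ ‖b‖ := fun y hy =>
    (norm_dotProduct_le u y).trans ((mul_le_of_le_one_left (norm_nonneg _) hu).trans hy)
  have hbc : ‖b * c‖ ≤ ‖b‖ := by
    rw [norm_mul]; exact mul_le_of_le_one_right (norm_nonneg _) hc
  split_ifs with hs
  swap
  · convert measure_empty (μ := haarPi K ι)
    refine Set.eq_empty_iff_forall_notMem.2 fun y hy => hs ?_
    have := IsUltrametricDist.norm_add_le_max (s - u ⬝ᵥ y) (u ⬝ᵥ y)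
    rw [sub_add_cancel] at this
    exact this.trans (max_le (hy.2.trans hbc) (hdot y hy.1))
  by_cases hc1 : ‖c‖ = 1
  · have : {y : ι → K | ‖y‖ ≤ ‖b‖ ∧ ‖s - u ⬝ᵥ y‖ ≤ ‖b * c‖} = closedBall 0 ‖b‖ := by
      ext y
      simp only [Set.mem_ofPred_eq, mem_closedBall_zero_iff, and_iff_left_iff_imp]
      intro hy
      rw [norm_mul, hc1, mul_one, sub_eq_add_neg]
      refine (IsUltrametricDist.norm_add_le_max _ _).trans (max_le hs ?_)
      rw [norm_neg]
      exact hdot y hy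
    rw [this, haarPi_closedBall hK, hc1, mul_one]
  · have hu1 := huc.resolve_left hc1
    have hne : Nonempty ι := by
      by_contra h0
      rw [not_nonempty_iff] at h0
      rw [Subsingleton.elim u 0, norm_zero] at hu1
      exact zero_ne_one hu1
    obtain ⟨k, hk⟩ := exists_norm_eq_norm u
    rw [hu1] at hk
    have hk0 : u k ≠ 0 := by rw [← norm_pos_iff, ← hk]; exact one_pos
    have mp := measurePreserving_shearEquiv hu1 hk0 hk.symm
    -- after the shear the set is a product of balls
    have hpre : {y : ι → K | ‖y‖ ≤ ‖b‖ ∧ ‖s - u ⬝ᵥ y‖ ≤ ‖b * c‖} =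
        shearEquiv u k hk0 ⁻¹' Set.univ.pi fun i =>
          if i = k then closedBall s ‖b * c‖ else closedBall 0 ‖b‖ := by
      ext y
      simp only [Set.mem_ofPred_eq, Set.mem_preimage, Set.mem_pi, Set.mem_univ, forall_const]
      rw [← norm_shearEquiv hu1 hk0 hk.symm y]
      have hy : u ⬝ᵥ y = shearEquiv u k hk0 y k := by
        rw [shearEquiv_apply, Function.update_self]
      rw [hy]
      set z := shearEquiv u k hk0 y
      constructor
      · rintro ⟨h1, h2⟩ i
        split_ifs with hi
        · rwa [hi, mem_closedBall, dist_comm, dist_eq_norm]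
        · rw [mem_closedBall_zero_iff]
          exact (norm_le_pi_norm z i).trans h1
      · intro h
        have hzk := h k
        rw [if_pos rfl, mem_closedBall, dist_comm, dist_eq_norm] at hzk
        refine ⟨(pi_norm_le_iff_of_nonneg (norm_nonneg _)).2 fun i => ?_, hzk⟩
        by_cases hi : i = k
        · have := IsUltrametricDist.norm_add_le_max s (-(s - z k))
          rw [norm_neg, ← sub_eq_add_neg, sub_sub_cancel] at this
          rw [hi]
          exact this.trans (max_le hs (hzk.trans hbc))
        · have := h i
          rwa [if_neg hi, mem_closedBall_zero_iff] at this
    have hms : MeasurableSet (Set.univ.pi fun i : ι =>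
        if i = k then closedBall s ‖b * c‖ else closedBall 0 ‖b‖) := by
      refine MeasurableSet.univ_pi fun i => ?_
      split_ifs <;> exact isClosed_closedBall.measurableSet
    rw [hpre, mp.measure_preimage hms.nullMeasurableSet, Measure.pi_pi]
    have hfac : ∀ i : ι, haar K (if i = k then closedBall s ‖b * c‖ else closedBall 0 ‖b‖) =
        (if i = k then ENNReal.ofReal ‖c‖ else 1) * ENNReal.ofReal ‖b‖ := by
      intro i
      split_ifs
      · rw [haar_closedBall_center hK, norm_mul, mul_comm, ENNReal.ofReal_mul (norm_nonneg _)]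
      · rw [haar_closedBall_center hK, one_mul]
    simp only [hfac]
    rw [Finset.prod_mul_distrib, Finset.prod_ite_eq' Finset.univ k, if_pos (Finset.mem_univ k),
      Finset.prod_const, Finset.card_univ, mul_comm, ENNReal.ofReal_mul (by positivity),
      ENNReal.ofReal_pow (norm_nonneg _)]

variable {n : ℕ}

/-- A hyperplane meets a ball in a set of measure `‖b‖ ^ (n - 1)`, or not at all. -/
theorem hyperplaneMeasure_closedBall (hK : IsNormalizedNorm K) {m : ℕ} {u : Fin (m + 1) → K}
    (hu : ‖u‖ = 1) (s : K) (a : Fin (m + 1) → K) (b : K) :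
    hyperplaneMeasure u s (closedBall a ‖b‖) =
      if ‖s - u ⬝ᵥ a‖ ≤ ‖b‖ then ENNReal.ofReal (‖b‖ ^ m) else 0 := by
  have hex : ∃ j, u j ≠ 0 := by
    by_contra! h
    rw [show u = 0 from funext h, norm_zero] at hu
    exact zero_ne_one hu
  rw [hyperplaneMeasure, dif_pos hex]
  set j := hex.choose
  have hj : u j ≠ 0 := hex.choose_spec
  have hj1 : ‖u j‖ ≤ 1 := hu ▸ norm_le_pi_norm u j
  set u' : {i : Fin (m + 1) // i ≠ j} → K := fun k => u k with hu'
  have hu'1 : ‖u'‖ ≤ 1 :=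
    (pi_norm_le_iff_of_nonneg zero_le_one).2 fun k => hu ▸ norm_le_pi_norm u k
  have hor : ‖u j‖ = 1 ∨ ‖u'‖ = 1 := by
    obtain ⟨i, hi⟩ := exists_norm_eq_norm u
    rw [hu] at hi
    by_cases h : i = j
    · exact Or.inl (h ▸ hi.symm)
    · exact Or.inr (le_antisymm hu'1 (hi.le.trans (norm_le_pi_norm u' ⟨i, h⟩)))
  have hcard : Fintype.card {i : Fin (m + 1) // i ≠ j} = m := by
    simp
  rw [Measure.smul_apply, Measure.map_apply (continuous_hyperplanePoint u s j).measurable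
    isClosed_closedBall.measurableSet,
    ← measure_preimage_add_right (haarPi K _) (fun k : {i : Fin (m + 1) // i ≠ j} => a k),
    hyperplanePoint_preimage_closedBall u s hj, haarPi_slab hK u' hj1 hu'1 hor, hcard]
  split_ifs
  · rw [smul_eq_mul, ← ENNReal.ofReal_mul (by positivity), mul_comm, mul_assoc,
      mul_inv_cancel₀ (norm_ne_zero_iff.2 hj), mul_one]
  · rw [smul_zero]

/-- The Radon transform, in a direction of norm `1`, of a linear combination of indicators of
balls of radius `‖b‖`. -/
theorem radon_sum_ballIndicator (hK : IsNormalizedNorm K) {χ : AddChar K Circle}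
    (hχ : IsRankZero K χ) {m : ℕ} {b : K} (hb : b ≠ 0) (A : Finset (Fin (m + 1) → K))
    (c : (Fin (m + 1) → K) → ℂ) {φ : (Fin (m + 1) → K) → ℂ}
    (hφ : ∀ x, φ x = ∑ a ∈ A, c a * ballIndicator ‖b‖ (x - a)) {u : Fin (m + 1) → K}
    (hu : ‖u‖ = 1) (s : K) :
    radon χ φ u s = (‖b‖ : ℂ) ^ m * ∑ a ∈ A, c a * ballIndicator ‖b‖ (s - u ⬝ᵥ a) := by
  have hbn : (‖b‖ : ℂ) ≠ 0 := by simpa using hb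
  rw [radon]
  split_ifs with hm
  · obtain rfl : m = 0 := by omega
    have hcont : ∀ ξ : Fin 1 → K, Continuous fun x : Fin 1 → K => (χ (x ⬝ᵥ ξ) : ℂ) := by
      intro ξ
      refine continuous_subtype_val.comp (hχ.continuous.comp ?_)
      simp only [dotProduct]
      fun_prop
    have hint : ∀ ξ a : Fin 1 → K, Integrable (fun x : Fin 1 → K =>
        c a * ((χ (x ⬝ᵥ ξ) : ℂ) * ballIndicator ‖b‖ (x - a))) (haarPi K (Fin 1)) := by
      intro ξ a
      simp only [ballIndicator_eq_indicator]
      refine Integrable.const_mul ?_ _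
      have : (fun x : Fin 1 → K => (χ (x ⬝ᵥ ξ) : ℂ) * (closedBall a ‖b‖).indicator 1 x) =
          (closedBall a ‖b‖).indicator fun x => (χ (x ⬝ᵥ ξ) : ℂ) := by
        ext x
        by_cases hx : x ∈ closedBall a ‖b‖ <;> simp [hx]
      rw [this, integrable_indicator_iff isClosed_closedBall.measurableSet]
      exact (hcont ξ).continuousOn.integrableOn_compact (isCompact_closedBall _ _)
    have hfour : ∀ ξ : Fin 1 → K, fourier χ φ ξ = ∑ a ∈ A, c a * ((χ (a ⬝ᵥ ξ) : ℂ) *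
        if ‖ξ‖ * ‖b‖ ≤ 1 then (‖b‖ : ℂ) else 0) := by
      intro ξ
      rw [fourier]
      simp only [hφ, Finset.mul_sum, mul_left_comm _ (c _)]
      rw [integral_finsetSum _ fun a _ => hint ξ a]
      refine Finset.sum_congr rfl fun a _ => ?_
      rw [integral_const_mul, fourier_ballIndicator hK hχ, pow_one]
    have hterm : ∀ a ∈ A, (fun r : K => (χ (-(r * s)) : ℂ) * (c a * ((χ (a ⬝ᵥ r • u) : ℂ) *
        if ‖r • u‖ * ‖b‖ ≤ 1 then (‖b‖ : ℂ) else 0))) = fun r => (c a * ‖b‖) *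
          ((χ (r * (u ⬝ᵥ a - s)) : ℂ) * ballIndicator ‖b⁻¹‖ r) := by
      intro a _
      ext r
      have h1 : ‖r • u‖ * ‖b‖ ≤ 1 ↔ ‖r‖ ≤ ‖b⁻¹‖ := by
        rw [norm_smul, hu, mul_one, norm_inv, ← one_div, le_div_iff₀ (norm_pos_iff.2 hb)]
      have h2 : r * (u ⬝ᵥ a - s) = -(r * s) + a ⬝ᵥ r • u := by
        rw [dotProduct_smul, smul_eq_mul, dotProduct_comm a u]; ring
      rw [h2, AddChar.map_add_eq_mul, Circle.coe_mul, ballIndicator]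
      simp only [h1]
      split_ifs <;> ring
    have hint2 : ∀ a ∈ A, Integrable (fun r : K => (c a * ‖b‖) *
          ((χ (r * (u ⬝ᵥ a - s)) : ℂ) * ballIndicator ‖b⁻¹‖ r)) (haar K) := by
      intro a _
      refine Integrable.const_mul ?_ _
      have hc : Continuous fun r : K => (χ (r * (u ⬝ᵥ a - s)) : ℂ) :=
        continuous_subtype_val.comp (hχ.continuous.comp (by fun_prop))
      have : (fun r : K => (χ (r * (u ⬝ᵥ a - s)) : ℂ) * ballIndicator ‖b⁻¹‖ r) =
          (closedBall 0 ‖b⁻¹‖).indicator fun r => (χ (r * (u ⬝ᵥ a - s)) : ℂ) := by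
        ext r
        rw [← sub_zero r, ballIndicator_eq_indicator, sub_zero]
        by_cases hx : r ∈ closedBall 0 ‖b⁻¹‖
        · rw [Set.indicator_of_mem hx, Set.indicator_of_mem hx, Pi.one_apply, mul_one]
        · rw [Set.indicator_of_notMem hx, Set.indicator_of_notMem hx, mul_zero]
      rw [this, integrable_indicator_iff isClosed_closedBall.measurableSet]
      exact hc.continuousOn.integrableOn_compact (isCompact_closedBall _ _)
    simp only [hfour, Finset.mul_sum]
    rw [integral_finsetSum _ fun a ha => by rw [hterm a ha]; exact hint2 a ha]
    refine Finset.sum_congr rfl fun a ha => ?_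
    rw [hterm a ha, integral_const_mul, integral_haar_character_ballIndicator hK hχ,
      ballIndicator, norm_sub_rev s]
    have h1 : ‖u ⬝ᵥ a - s‖ * ‖b⁻¹‖ ≤ 1 ↔ ‖u ⬝ᵥ a - s‖ ≤ ‖b‖ := by
      rw [norm_inv, ← div_eq_mul_inv, div_le_one (norm_pos_iff.2 hb)]
    simp only [h1]
    split_ifs
    · rw [norm_inv]
      push_cast
      field_simp
    · simp
  · simp only [hφ, ballIndicator_eq_indicator ‖b‖ (_ : Fin (m + 1) → K)]
    have hfin : ∀ a, hyperplaneMeasure u s (closedBall a ‖b‖) ≠ ⊤ := by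
      intro a
      rw [hyperplaneMeasure_closedBall hK hu]
      split_ifs <;> simp
    rw [integral_finsetSum _ fun a _ => Integrable.const_mul
      ((integrable_indicator_iff isClosed_closedBall.measurableSet).2
        (integrableOn_const (hfin a))) _, Finset.mul_sum]
    refine Finset.sum_congr rfl fun a _ => ?_
    rw [integral_const_mul, integral_indicator_one_complex isClosed_closedBall.measurableSet,
      Measure.real, hyperplaneMeasure_closedBall hK hu, ballIndicator]
    split_ifs
    · rw [ENNReal.toReal_ofReal (by positivity)]
      push_cast
      ring
    · simp

end Hyperplane

/-! ### Inversion of the Radon transform -/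

section SphereIntegral

variable {K : Type*} [NontriviallyNormedField K] [IsUltrametricDist K] [ProperSpace K]
  [MeasurableSpace K] [BorelSpace K]

/-- The mean of a plane function over the unit ball of `K^n` is a mean over the ring of integers:
shear the direction `v` to a coordinate axis. -/
theorem setIntegral_closedBall_dotProduct {m : ℕ} {v : Fin (m + 1) → K} (hv : ‖v‖ = 1)
    (f : K → ℂ) :
    ∫ u in closedBall (0 : Fin (m + 1) → K) 1, f (v ⬝ᵥ u) ∂(haarPi K (Fin (m + 1))) =
      ∫ z in closedBall (0 : K) 1, f z ∂(haar K) := by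
  obtain ⟨j, hj⟩ := exists_norm_eq_norm v
  rw [hv] at hj
  have hj0 : v j ≠ 0 := by rw [← norm_pos_iff, ← hj]; exact one_pos
  have mp := measurePreserving_shearEquiv hv hj0 hj.symm
  have h1 := mp.setIntegral_preimage_emb (shearEquiv v j hj0).toHomeomorph.measurableEmbedding
    (fun z => f (z j)) (closedBall 0 1)
  have hpre : shearEquiv v j hj0 ⁻¹' closedBall 0 1 = closedBall 0 1 := by
    ext u
    simp [norm_shearEquiv hv hj0 hj.symm]
  simp only [hpre, shearEquiv_apply, Function.update_self] at h1
  rw [h1]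
  have mp2 := measurePreserving_piFinSuccAbove (fun _ : Fin (m + 1) => haar K) j
  have me2 := (MeasurableEquiv.piFinSuccAbove (fun _ : Fin (m + 1) => K) j).measurableEmbedding
  have h2 := mp2.setIntegral_preimage_emb me2 (fun p => f p.1 * (fun _ => 1) p.2)
    (closedBall (0 : K) 1 ×ˢ closedBall (0 : Fin m → K) 1)
  have hpre2 : MeasurableEquiv.piFinSuccAbove (fun _ : Fin (m + 1) => K) j ⁻¹'
      (closedBall (0 : K) 1 ×ˢ closedBall (0 : Fin m → K) 1) = closedBall 0 1 := by
    ext z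
    simp only [Set.mem_preimage, Set.mem_prod, mem_closedBall_zero_iff, pi_norm_eq_max z j,
      max_le_iff]
    rfl
  rw [hpre2] at h2
  replace h2 := h2.trans (setIntegral_prod_mul f (fun _ => 1) _ _)
  rw [setIntegral_const, Measure.real] at h2
  have h3 : (Measure.pi fun _ : Fin m => haar K) (closedBall 0 1) = 1 := haarPi_closedBall_one
  rw [h3] at h2
  simpa using h2

theorem setIntegral_closedBall_smul (hK : IsNormalizedNorm K) {ι : Type*} [Fintype ι] {a : K}
    (ha : a ≠ 0) (f : (ι → K) → ℂ) :
    ∫ u in closedBall (0 : ι → K) ‖a‖, f u ∂(haarPi K ι) =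
      (‖a‖ : ℂ) ^ Fintype.card ι * ∫ u in closedBall (0 : ι → K) 1, f (a • u) ∂(haarPi K ι) := by
  rw [← integral_indicator isClosed_closedBall.measurableSet, integral_comp_smul hK ha,
    ← integral_indicator isClosed_closedBall.measurableSet]
  congr 2
  ext u
  have h : a • u ∈ closedBall (0 : ι → K) ‖a‖ ↔ u ∈ closedBall (0 : ι → K) 1 := by
    rw [mem_closedBall_zero_iff, mem_closedBall_zero_iff, norm_smul,
      mul_le_iff_le_one_right (norm_pos_iff.2 ha)]
  by_cases hu : u ∈ closedBall (0 : ι → K) 1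
  · rw [Set.indicator_of_mem hu, Set.indicator_of_mem (h.2 hu)]
  · rw [Set.indicator_of_notMem hu, Set.indicator_of_notMem (mt h.1 hu)]

/-- Integration over the unit sphere, as the unit ball without the ball of radius `‖β‖`. -/
theorem setIntegral_sphere_dotProduct (hK : IsNormalizedNorm K) {m : ℕ} {v : Fin (m + 1) → K}
    (hv : ‖v‖ = 1) {β : K} (hβ : ‖β‖ = (q K : ℝ)⁻¹) {f : K → ℂ} (hf : Continuous f) (a : K) :
    ∫ u in sphere (0 : Fin (m + 1) → K) 1, f (a * (v ⬝ᵥ u)) ∂(haarPi K (Fin (m + 1))) =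
      ∫ z in closedBall (0 : K) 1, f (a * z) ∂(haar K) -
        ((q K : ℂ) ^ (m + 1))⁻¹ * ∫ z in closedBall (0 : K) 1, f (a * β * z) ∂(haar K) := by
  have hq := one_lt_q hK
  have hβ0 : β ≠ 0 := by rw [← norm_pos_iff, hβ]; positivity
  have hcont : Continuous fun u : Fin (m + 1) → K => f (a * (v ⬝ᵥ u)) := by
    have : Continuous fun u : Fin (m + 1) → K => v ⬝ᵥ u := by simp only [dotProduct]; fun_prop
    exact hf.comp (continuous_const.mul this)
  have hball : ball (0 : Fin (m + 1) → K) 1 = closedBall 0 ‖β‖ := by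
    have := ball_eq_closedBall (ι := Fin (m + 1)) hK hβ (one_ne_zero (α := K))
    rwa [norm_one, mul_one] at this
  rw [← closedBall_sdiff_ball, setIntegral_sdiff isOpen_ball.measurableSet
    (hcont.continuousOn.integrableOn_compact (isCompact_closedBall _ _)) ball_subset_closedBall,
    hball, setIntegral_closedBall_smul hK hβ0, setIntegral_closedBall_dotProduct hv
      (fun z => f (a * z)), Fintype.card_fin, hβ]
  simp only [dotProduct_smul, smul_eq_mul, ← mul_assoc]
  rw [setIntegral_closedBall_dotProduct hv (fun z => f (a * β * z))]
  push_cast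
  rw [inv_pow]

end SphereIntegral

section TailProfile

variable {K : Type*} [NontriviallyNormedField K] [IsUltrametricDist K]

/-- The closed form of `D^m` applied to the indicator of the ball of radius `‖b‖` in `K`
(see `fracD_ballIndicator`). -/
noncomputable def tailProfile (m : ℕ) (b s : K) : ℝ :=
  if ‖s‖ ≤ ‖b‖ then (1 - (q K : ℝ)⁻¹) / (1 - ((q K : ℝ) ^ (m + 1))⁻¹) / ‖b‖ ^ m
  else ‖b‖ * ((1 - (q K : ℝ) ^ m) / (1 - ((q K : ℝ) ^ (m + 1))⁻¹)) / ‖s‖ ^ (m + 1)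

theorem tailProfile_eq_of_norm_eq (m : ℕ) (b : K) {s t : K} (h : ‖s‖ = ‖t‖) :
    tailProfile m b s = tailProfile m b t := by
  simp only [tailProfile, h]

theorem tailProfile_add (m : ℕ) (b : K) (s : K) {t : K} (ht : ‖t‖ ≤ ‖b‖) :
    tailProfile m b (s + t) = tailProfile m b s := by
  by_cases hs : ‖s‖ ≤ ‖b‖
  · have : ‖s + t‖ ≤ ‖b‖ := (IsUltrametricDist.norm_add_le_max _ _).trans (max_le hs ht)
    rw [tailProfile, tailProfile, if_pos hs, if_pos this]
  · refine tailProfile_eq_of_norm_eq m b (norm_eq_of_norm_sub_lt ?_)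
    rw [add_sub_cancel_left]
    exact ht.trans_lt (not_le.1 hs)

theorem exists_norm_tailProfile_le (m : ℕ) {b : K} (hb : b ≠ 0) :
    ∃ C : ℝ, ∀ s : K, ‖(tailProfile m b s : ℂ)‖ ≤ C := by
  have hb' := norm_pos_iff.2 hb
  refine ⟨max |(1 - (q K : ℝ)⁻¹) / (1 - ((q K : ℝ) ^ (m + 1))⁻¹) / ‖b‖ ^ m|
    (|‖b‖ * ((1 - (q K : ℝ) ^ m) / (1 - ((q K : ℝ) ^ (m + 1))⁻¹))| / ‖b‖ ^ (m + 1)),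
    fun s => ?_⟩
  rw [Complex.norm_real, Real.norm_eq_abs, tailProfile]
  split_ifs with h
  · exact le_max_left _ _
  · refine le_max_of_le_right ?_
    rw [abs_div, abs_of_nonneg (by positivity : 0 ≤ ‖s‖ ^ (m + 1))]
    gcongr
    exact (not_le.1 h).le

theorem isLocConst_tailProfile (m : ℕ) {b : K} (hb : b ≠ 0) :
    IsLocConst fun s : K => (tailProfile m b s : ℂ) :=
  ⟨‖b‖, norm_pos_iff.2 hb, fun s t ht => by simp only [tailProfile_add m b s ht]⟩

variable [ProperSpace K] [MeasurableSpace K] [BorelSpace K]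

theorem fracD_ballIndicator (hK : IsNormalizedNorm K) (m : ℕ) {b : K} (hb : b ≠ 0) (s : K) :
    fracD m (ballIndicator ‖b‖) s = tailProfile m b s := by
  have hq := one_lt_q hK
  have hq0 : (0 : ℝ) < q K := by positivity
  have hb' := norm_pos_iff.2 hb
  rcases Nat.eq_zero_or_pos m with rfl | hm
  · have : 1 - (q K : ℝ)⁻¹ ≠ 0 := by
      have := inv_lt_one_of_one_lt₀ hq
      linarith
    by_cases h : ‖s‖ ≤ ‖b‖ <;> simp [fracD, ballIndicator, tailProfile, h, this]
  have hm0 : (m : ℝ) ≠ 0 := by exact_mod_cast hm.ne'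
  have hexp : -(m : ℝ) - 1 = -((m + 1 : ℕ) : ℝ) := by push_cast; ring
  have hpow : ∀ r : ℝ, 0 ≤ r → r ^ (-(m : ℝ) - 1) = (r ^ (m + 1))⁻¹ := fun r hr => by
    rw [hexp, Real.rpow_neg hr, Real.rpow_natCast]
  have hqm : (1 : ℝ) < (q K : ℝ) ^ m := one_lt_pow₀ hq hm.ne'
  have hqm1 : (1 : ℝ) < (q K : ℝ) ^ (m + 1) := one_lt_pow₀ hq (by omega)
  rw [fracD, if_neg hm0, hpow _ hq0.le, Real.rpow_natCast]
  by_cases hs : ‖s‖ ≤ ‖b‖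
  · have hms : MeasurableSet {y : K | ‖b‖ < ‖y‖} := measurableSet_lt_norm _
    have hint : fracIntegrand (m : ℝ) (ballIndicator ‖b‖) s = fun y => (({y : K | ‖b‖ <
        ‖y‖}.indicator (fun y => -‖y‖ ^ (-((m + 1 : ℕ) : ℝ))) y : ℝ) : ℂ) := by
      ext y
      have h1 : ballIndicator ‖b‖ s = 1 := if_pos hs
      have h2 : ballIndicator ‖b‖ (s - y) = ballIndicator ‖b‖ y := by
        rw [sub_eq_add_neg, add_comm, ballIndicator_add _ hs, ballIndicator, norm_neg,
          ballIndicator]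
      rw [fracIntegrand, h1, h2, hexp]
      by_cases hy : ‖b‖ < ‖y‖
      · rw [Set.indicator_of_mem (show y ∈ {y : K | ‖b‖ < ‖y‖} from hy), ballIndicator,
          if_neg (not_le.2 hy)]
        push_cast
        ring
      · rw [Set.indicator_of_notMem (show y ∉ {y : K | ‖b‖ < ‖y‖} from hy), ballIndicator,
          if_pos (not_lt.1 hy)]
        simp
    rw [hint, integral_complex_ofReal, integral_indicator hms, integral_neg,
      integral_haar_norm_rpow_tail hK (by exact_mod_cast (by omega : 1 < m + 1)) hb,
      Real.rpow_neg hb'.le, Real.rpow_natCast, Real.rpow_neg hq0.le, Real.rpow_natCast,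
      tailProfile, if_pos hs, ← Complex.ofReal_mul]
    congr 1
    have e1 : 1 - ((q K : ℝ) ^ (m + 1))⁻¹ ≠ 0 := by
      have := inv_lt_one_of_one_lt₀ hqm1
      linarith
    have e2 : 1 - (q K : ℝ) * ((q K : ℝ) ^ (m + 1))⁻¹ = ((q K : ℝ) ^ m - 1) / (q K : ℝ) ^ m := by
      rw [pow_succ]; field_simp
    have e3 : (q K : ℝ) ^ m - 1 ≠ 0 := by linarith
    rw [e2]
    field_simp
    ring
  · have hs' : ‖b‖ < ‖s‖ := not_le.1 hs
    have hint : fracIntegrand (m : ℝ) (ballIndicator ‖b‖) s = fun y =>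
        ((‖s‖ ^ (m + 1))⁻¹ : ℝ) * (closedBall s ‖b‖).indicator (1 : K → ℂ) y := by
      ext y
      have h1 : ballIndicator ‖b‖ s = 0 := if_neg hs
      rw [fracIntegrand, h1, ← ballIndicator_eq_indicator, sub_zero, hpow _ (norm_nonneg _),
        ballIndicator, ballIndicator, norm_sub_rev y s]
      split_ifs with h
      · rw [norm_sub_rev] at h
        rw [norm_eq_of_norm_sub_lt (h.trans_lt hs')]
      · simp
    rw [hint, integral_const_mul, integral_indicator_one_complex
      isClosed_closedBall.measurableSet, haar_real_closedBall hK, tailProfile, if_neg hs,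
      ← Complex.ofReal_mul, ← Complex.ofReal_mul]
    congr 1
    ring

/-- The means of `tailProfile` over balls. Outside the ball of radius `‖b‖` they decay as
`‖a‖ ^ (-(m + 1))`, which makes the spherical means over `K^(m + 1)` vanish there. -/
theorem setIntegral_tailProfile (hK : IsNormalizedNorm K) (m : ℕ) {b : K} (hb : b ≠ 0) (a : K) :
    ∫ z in closedBall (0 : K) 1, (tailProfile m b (a * z) : ℂ) ∂(haar K) =
      ((1 - (q K : ℝ)⁻¹) / (1 - ((q K : ℝ) ^ (m + 1))⁻¹) * ‖b‖ / (max ‖a‖ ‖b‖) ^ (m + 1) : ℝ)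
      := by
  obtain ⟨hq, β, hβ, -⟩ := exists_uniformizer hK
  have hq0 : (0 : ℝ) < q K := by positivity
  have hb' := norm_pos_iff.2 hb
  have hβ0 : β ≠ 0 := by rw [← norm_pos_iff, hβ]; positivity
  have hvol : (haar K).real (closedBall 0 1) = 1 := by
    rw [Measure.real, haar_closedBall_one]; rfl
  have small : ∀ a : K, ‖a‖ ≤ ‖b‖ →
      ∫ z in closedBall (0 : K) 1, (tailProfile m b (a * z) : ℂ) ∂(haar K) =
      ((1 - (q K : ℝ)⁻¹) / (1 - ((q K : ℝ) ^ (m + 1))⁻¹) * ‖b‖ / (max ‖a‖ ‖b‖) ^ (m + 1) : ℝ)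
      := by
    intro a ha
    have : Set.EqOn (fun z : K => (tailProfile m b (a * z) : ℂ))
        (fun _ => (((1 - (q K : ℝ)⁻¹) / (1 - ((q K : ℝ) ^ (m + 1))⁻¹) / ‖b‖ ^ m : ℝ) : ℂ))
        (closedBall 0 1) := by
      intro z hz
      rw [mem_closedBall_zero_iff] at hz
      have : ‖a * z‖ ≤ ‖b‖ := by
        rw [norm_mul]
        exact (mul_le_of_le_one_right (norm_nonneg _) hz).trans ha
      simp only [tailProfile, if_pos this]
    rw [setIntegral_congr_fun isClosed_closedBall.measurableSet this, setIntegral_const, hvol,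
      one_smul, max_eq_right ha, pow_succ ‖b‖]
    congr 1
    field_simp
  by_cases ha : ‖a‖ ≤ ‖b‖
  · exact small a ha
  -- induction on `k` with `‖a‖ = ‖b‖ * q ^ k`, peeling off the outermost sphere
  have step : ∀ (k : ℕ) (a : K), ‖a‖ = ‖b‖ * (q K : ℝ) ^ k →
      ∫ z in closedBall (0 : K) 1, (tailProfile m b (a * z) : ℂ) ∂(haar K) =
      ((1 - (q K : ℝ)⁻¹) / (1 - ((q K : ℝ) ^ (m + 1))⁻¹) * ‖b‖ / (max ‖a‖ ‖b‖) ^ (m + 1) : ℝ)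
      := by
    intro k
    induction k with
    | zero => exact fun a ha => small a (by rw [ha, pow_zero, mul_one])
    | succ k ih =>
      intro a ha
      have hba : ‖b‖ < ‖a‖ := by
        rw [ha]; exact lt_mul_of_one_lt_right hb' (one_lt_pow₀ hq (by omega))
      have ha0 : 0 < ‖a‖ := hb'.trans hba
      have haβ : ‖a * β‖ = ‖b‖ * (q K : ℝ) ^ k := by
        rw [norm_mul, ha, hβ, pow_succ]; field_simp
      have hbaβ : ‖b‖ ≤ ‖a * β‖ := by
        rw [haβ]; exact le_mul_of_one_le_right hb'.le (one_le_pow₀ hq.le)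
      have hS := setIntegral_sphere_dotProduct (m := 0) (v := fun _ => (1 : K)) hK (by simp) hβ
        (isLocConst_tailProfile m hb).continuous a
      have hconst : Set.EqOn (fun u : Fin (0 + 1) → K =>
          (tailProfile m b (a * ((fun _ => (1 : K)) ⬝ᵥ u)) : ℂ))
          (fun _ => (tailProfile m b a : ℂ)) (sphere 0 1) := by
        intro u hu
        rw [mem_sphere_zero_iff_norm] at hu
        obtain ⟨j, hj⟩ := exists_norm_eq_norm u
        simp only
        rw [tailProfile_eq_of_norm_eq m b (t := a)]
        rw [norm_mul]
        have : (fun _ : Fin (0 + 1) => (1 : K)) ⬝ᵥ u = u j := by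
          rw [Fin.fin_one_eq_zero j]
          simp [dotProduct]
        rw [this, ← hj, hu, mul_one]
      have hsph := haarPi_real_sphere (ι := Fin (0 + 1)) hK (one_ne_zero (α := K))
      rw [norm_one] at hsph
      rw [setIntegral_congr_fun isClosed_sphere.measurableSet hconst, setIntegral_const, hsph,
        ih _ haβ, eq_sub_iff_add_eq, Complex.real_smul] at hS
      rw [← hS, tailProfile, if_neg (not_le.2 hba), max_eq_left hbaβ, max_eq_left hba.le,
        norm_mul, hβ, Fintype.card_fin]
      have e1 : 1 - ((q K : ℝ) ^ (m + 1))⁻¹ ≠ 0 := by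
        have := inv_lt_one_of_one_lt₀ (one_lt_pow₀ hq (by omega) : (1 : ℝ) < (q K : ℝ) ^ (m + 1))
        linarith
      have hcast : ((q K : ℂ) ^ (0 + 1))⁻¹ = (((q K : ℝ)⁻¹ : ℝ) : ℂ) := by
        push_cast
        rw [pow_one]
      rw [hcast, ← Complex.ofReal_mul, ← Complex.ofReal_mul, ← Complex.ofReal_add]
      congr 1
      rw [mul_pow, inv_pow]
      generalize 1 - ((q K : ℝ) ^ (m + 1))⁻¹ = d at e1
      field_simp
      ring
  have ha0 : a ≠ 0 := by
    rintro rfl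
    rw [norm_zero] at ha
    exact ha hb'.le
  obtain ⟨k, hk⟩ := exists_norm_eq_zpow hK ha0
  obtain ⟨l, hl⟩ := exists_norm_eq_zpow hK hb
  have hlt : l < k := by
    rw [hk, hl, not_le] at ha
    exact (zpow_lt_zpow_iff_right₀ hq).1 ha
  refine step (k - l).toNat a ?_
  rw [hk, hl, ← zpow_natCast, ← zpow_add₀ hq0.ne', Int.toNat_of_nonneg (by omega)]
  congr 1
  ring

/-- Inversion formula for the indicator of a ball: the spherical mean of its filtered Radon
transform gives it back. -/
theorem setIntegral_sphere_tailProfile (hK : IsNormalizedNorm K) {m : ℕ} {b : K} (hb : b ≠ 0)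
    (x : Fin (m + 1) → K) :
    ∫ u in sphere (0 : Fin (m + 1) → K) 1, (tailProfile m b (u ⬝ᵥ x) : ℂ)
        ∂(haarPi K (Fin (m + 1))) =
      (1 - (q K : ℂ)⁻¹) / (‖b‖ : ℂ) ^ m * ballIndicator ‖b‖ x := by
  obtain ⟨hq, β, hβ, -⟩ := exists_uniformizer hK
  have hq0 : (0 : ℝ) < q K := by positivity
  have hb' := norm_pos_iff.2 hb
  have hβ1 : ‖β‖ < 1 := by rw [hβ]; exact inv_lt_one_of_one_lt₀ hq
  obtain ⟨a, v, hv, rfl⟩ := exists_norm_eq_one_and_eq_smul x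
  have hd : ∀ u : Fin (m + 1) → K, u ⬝ᵥ a • v = a * (v ⬝ᵥ u) := fun u => by
    rw [dotProduct_smul, smul_eq_mul, dotProduct_comm]
  simp only [hd]
  rw [setIntegral_sphere_dotProduct hK hv hβ (isLocConst_tailProfile m hb).continuous a,
    setIntegral_tailProfile hK m hb, setIntegral_tailProfile hK m hb, ballIndicator, norm_smul,
    hv, mul_one]
  have e1 : 1 - ((q K : ℝ) ^ (m + 1))⁻¹ ≠ 0 := by
    have := inv_lt_one_of_one_lt₀ (one_lt_pow₀ hq (by omega) : (1 : ℝ) < (q K : ℝ) ^ (m + 1))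
    linarith
  have hcast : ((q K : ℂ) ^ (m + 1))⁻¹ = ((((q K : ℝ) ^ (m + 1))⁻¹ : ℝ) : ℂ) := by
    push_cast
    rfl
  rw [hcast, ← Complex.ofReal_mul, ← Complex.ofReal_sub]
  split_ifs with h
  · have h2 : ‖a * β‖ ≤ ‖b‖ := by
      rw [norm_mul]
      exact (mul_le_of_le_one_right (norm_nonneg _) hβ1.le).trans h
    have hr : (1 - (q K : ℂ)⁻¹) / (‖b‖ : ℂ) ^ m * 1 = (((1 - (q K : ℝ)⁻¹) / ‖b‖ ^ m : ℝ) : ℂ) := by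
      push_cast
      ring
    rw [max_eq_right h, max_eq_right h2, hr]
    congr 1
    rw [← one_sub_mul, div_mul_eq_mul_div, ← mul_div_assoc, mul_comm, div_mul_eq_mul_div,
      mul_assoc, mul_comm (‖b‖) _, ← mul_assoc]
    rw [pow_succ ‖b‖]
    generalize 1 - ((q K : ℝ) ^ (m + 1))⁻¹ = d at e1
    field_simp
  · have hba : ‖b‖ < ‖a‖ := not_le.1 h
    have h2 : ‖b‖ ≤ ‖a * β‖ := by
      by_contra! h3
      refine h (norm_le_of_norm_lt hK ?_)
      rw [norm_mul, hβ] at h3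
      rwa [← div_eq_mul_inv, div_lt_iff₀ hq0] at h3
    have ha0 : 0 < ‖a‖ := hb'.trans hba
    rw [max_eq_left hba.le, max_eq_left h2, mul_zero, norm_mul, hβ, ← Complex.ofReal_zero]
    congr 1
    rw [mul_pow, inv_pow]
    field_simp
    ring

end TailProfile

/-! ### Profile families from translates and the Cauchy problem -/

section Radon

variable {K : Type*} [NontriviallyNormedField K] {n : ℕ}

/-- The profiles `κ ∑ c a h (s - u · a)`: the translates of the radial profile `h` to the points
`a`, seen in the direction `u`. -/
noncomputable def sumProfile (κ : ℂ) (A : Finset (Fin n → K)) (c : (Fin n → K) → ℂ) (h : K → ℂ)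
    (u : Fin n → K) (s : K) : ℂ :=
  κ * ∑ a ∈ A, c a * h (s - u ⬝ᵥ a)

theorem sumProfile_add_dotProduct (κ : ℂ) (A : Finset (Fin n → K)) (c : (Fin n → K) → ℂ)
    (h : K → ℂ) (u x : Fin n → K) (t : K) :
    sumProfile κ A c h u (t + u ⬝ᵥ x) = κ * ∑ a ∈ A, c a * h (t + u ⬝ᵥ (x - a)) := by
  simp only [sumProfile, dotProduct_sub, add_sub_assoc]

theorem isProfileFamily_sumProfile [ProperSpace K] [MeasurableSpace K] [BorelSpace K] (κ : ℂ)
    (A : Finset (Fin n → K)) (c : (Fin n → K) → ℂ) {h : K → ℂ} (hl : IsLocConst h) {C : ℝ}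
    (hC : ∀ s, ‖h s‖ ≤ C) (hrad : ∀ s t, ‖s‖ = ‖t‖ → h s = h t) :
    IsProfileFamily (sumProfile κ A c h) := by
  refine ⟨?_, ⟨‖κ‖ * ∑ a ∈ A, ‖c a‖ * C, fun u s => ?_⟩, ?_, fun ε u s hε => ?_⟩
  · have hcont : Continuous (Function.uncurry (sumProfile κ A c h)) := by
      refine continuous_const.mul (continuous_finsetSum _ fun a _ => continuous_const.mul ?_)
      have : Continuous fun p : (Fin n → K) × K => p.2 - p.1 ⬝ᵥ a := by
        simp only [dotProduct]; fun_prop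
      exact hl.continuous.comp this
    exact hcont.measurable
  · rw [sumProfile, norm_mul]
    refine mul_le_mul_of_nonneg_left (norm_sum_le_of_le _ fun a _ => ?_) (norm_nonneg _)
    rw [norm_mul]
    exact mul_le_mul_of_nonneg_left (hC _) (norm_nonneg _)
  · obtain ⟨δ, hδ, hc⟩ := hl
    refine ⟨δ, hδ, fun u s s' hs' => ?_⟩
    simp only [sumProfile, add_sub_right_comm, hc _ _ hs']
  · simp only [sumProfile, smul_dotProduct, smul_eq_mul, ← mul_sub]
    congr 1
    refine Finset.sum_congr rfl fun a _ => ?_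
    rw [hrad (ε * (s - u ⬝ᵥ a)) (s - u ⬝ᵥ a) (by rw [norm_mul, hε, one_mul])]

variable [IsUltrametricDist K] [ProperSpace K] [MeasurableSpace K] [BorelSpace K]

theorem fracD_sumProfile (hK : IsNormalizedNorm K) (κ : ℂ) (A : Finset (Fin n → K))
    (c : (Fin n → K) → ℂ) {h : K → ℂ} (hl : IsLocConst h) {C : ℝ} (hC : ∀ s, ‖h s‖ ≤ C) {α : ℝ}
    (hα : 0 ≤ α) (u : Fin n → K) (s : K) :
    fracD α (sumProfile κ A c h u) s = sumProfile κ A c (fracD α h) u s := by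
  rcases hα.eq_or_lt with h0 | h0
  · simp only [sumProfile, fracD, if_pos h0.symm]
  have hint : ∀ a, Integrable (fracIntegrand α h (s - u ⬝ᵥ a)) (haar K) := fun a =>
    (fracDExists_of_isLocConst hK hα hl hC (s - u ⬝ᵥ a)).resolve_left h0.ne'
  have hI : fracIntegrand α (sumProfile κ A c h u) s = fun y =>
      κ * ∑ a ∈ A, c a * fracIntegrand α h (s - u ⬝ᵥ a) y := by
    ext y
    simp only [fracIntegrand, sumProfile, sub_right_comm s y]
    rw [← mul_sub, ← Finset.sum_sub_distrib, mul_left_comm, Finset.mul_sum]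
    congr 1
    refine Finset.sum_congr rfl fun a _ => ?_
    ring
  simp only [sumProfile]
  rw [fracD, if_neg h0.ne', hI, integral_const_mul,
    integral_finsetSum _ fun a _ => (hint a).const_mul _]
  simp only [fracD, if_neg h0.ne', integral_const_mul]
  rw [mul_left_comm, Finset.mul_sum]
  congr 1
  refine Finset.sum_congr rfl fun a _ => ?_
  ring

theorem waveKernelD_eq (χ : AddChar K Circle) (φ : (Fin n → K) → ℂ) (t : K) (x u : Fin n → K) :
    waveKernelD χ φ t x u = fracD ((n : ℝ) - 1) (radon χ φ u) (t + u ⬝ᵥ x) :=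
  fracD_comp_add_right _ _ _ _

theorem sphereMean_congr {G G' : (Fin n → K) → K → ℂ}
    (h : ∀ u s, ‖u‖ = 1 → G u s = G' u s) (t : K) (x : Fin n → K) :
    sphereMean G t x = sphereMean G' t x :=
  setIntegral_congr_fun isClosed_sphere.measurableSet fun u hu =>
    h u _ (mem_sphere_zero_iff_norm.1 hu)

theorem const_mul_sphereMean (κ κ' : ℂ) (A : Finset (Fin n → K)) (c : (Fin n → K) → ℂ)
    (h : K → ℂ) (t : K) (x : Fin n → K) :
    κ * sphereMean (sumProfile κ' A c h) t x = sphereMean (sumProfile (κ * κ') A c h) t x := by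
  simp only [sphereMean, sumProfile, mul_assoc κ κ', integral_const_mul]

end Radon

theorem isLocConst_ballIndicator {E : Type*} [NormedAddCommGroup E] [IsUltrametricDist E] {r : ℝ}
    (hr : 0 < r) : IsLocConst (ballIndicator r : E → ℂ) :=
  ⟨r, hr, fun x _ hy => ballIndicator_add x hy⟩

end NAWave

open NAWave in
theorem theorem1 {K : Type*} [NontriviallyNormedField K] [IsUltrametricDist K] [ProperSpace K]
    [MeasurableSpace K] [BorelSpace K] (hK : NAWave.IsNormalizedNorm K)
    (χ : AddChar K Circle) (hχ : NAWave.IsRankZero K χ)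
    (n : ℕ) (hn : 1 ≤ n) (φ : (Fin n → K) → ℂ) (hφ : NAWave.IsTestFunction φ) :
    NAWave.IntegralsConverge χ φ ∧
    (NAWave.IsClassicalSolution (NAWave.F₁ χ φ) ∧
      ∀ x : Fin n → K, NAWave.F₁ χ φ 0 x = φ x) ∧
    (NAWave.IsClassicalSolution (NAWave.F₂ χ φ) ∧
      ∀ x : Fin n → K,
        NAWave.FracDExists ((n : ℝ) - 1) (fun t => NAWave.F₂ χ φ t x) 0 ∧
        NAWave.fracD ((n : ℝ) - 1) (fun t => NAWave.F₂ χ φ t x) 0 = φ x) := by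
  obtain ⟨m, rfl⟩ : ∃ m, n = m + 1 := ⟨n - 1, by omega⟩
  have hm : ((m + 1 : ℕ) : ℝ) - 1 = m := by push_cast; ring
  have hq := one_lt_q hK
  obtain ⟨δ, hδ, hdec⟩ := hφ.exists_eq_sum_ballIndicator
  obtain ⟨b, hb', hbδ⟩ := NormedField.exists_norm_lt K hδ
  have hb : b ≠ 0 := norm_pos_iff.1 hb'
  obtain ⟨A, c, hAc⟩ := hdec ‖b‖ hb' hbδ.le
  -- the Radon transform of `φ` and its derivative `D^m` as profile families
  have hl := isLocConst_ballIndicator (E := K) hb'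
  have hl1 := isLocConst_tailProfile m hb
  obtain ⟨C1, hC1⟩ := exists_norm_tailProfile_le m hb
  have hG : ∀ κ, IsProfileFamily (sumProfile κ A c (ballIndicator ‖b‖)) := fun κ =>
    isProfileFamily_sumProfile κ A c hl (norm_ballIndicator_le _)
      fun s t hst => by simp only [ballIndicator, hst]
  have hG1 : ∀ κ, IsProfileFamily (sumProfile κ A c fun s => (tailProfile m b s : ℂ)) := fun κ =>
    isProfileFamily_sumProfile κ A c hl1 hC1
      fun s t hst => by rw [tailProfile_eq_of_norm_eq m b hst]
  have hD : ∀ κ u, fracD (m : ℝ) (sumProfile κ A c (ballIndicator ‖b‖) u) =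
      sumProfile κ A c (fun s => (tailProfile m b s : ℂ)) u := fun κ u => by
    ext s
    rw [fracD_sumProfile hK κ A c hl (norm_ballIndicator_le _) m.cast_nonneg]
    simp only [sumProfile, fracD_ballIndicator hK m hb]
  have hR : ∀ u : Fin (m + 1) → K, ‖u‖ = 1 →
      radon χ φ u = sumProfile ((‖b‖ : ℂ) ^ m) A c (ballIndicator ‖b‖) u := fun u hu =>
    funext fun s => radon_sum_ballIndicator hK hχ hb A c hAc hu s
  have hR1 : ∀ (t : K) (x u : Fin (m + 1) → K), ‖u‖ = 1 → waveKernelD χ φ t x u =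
      sumProfile ((‖b‖ : ℂ) ^ m) A c (fun s => (tailProfile m b s : ℂ)) u (t + u ⬝ᵥ x) :=
    fun t x u hu => by rw [waveKernelD_eq, hm, hR u hu, hD]
  set κ : ℂ := (1 - (q K : ℂ)⁻¹)⁻¹ * (‖b‖ : ℂ) ^ m with hκ
  have hF1 : F₁ χ φ = sphereMean (sumProfile κ A c fun s => (tailProfile m b s : ℂ)) := by
    ext t x
    rw [hκ, ← const_mul_sphereMean, F₁]
    congr 1
    exact setIntegral_congr_fun isClosed_sphere.measurableSet fun u hu =>
      hR1 t x u (mem_sphere_zero_iff_norm.1 hu)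
  have hF2 : F₂ χ φ = sphereMean (sumProfile κ A c (ballIndicator ‖b‖)) := by
    ext t x
    rw [hκ, ← const_mul_sphereMean, F₂]
    congr 1
    refine setIntegral_congr_fun isClosed_sphere.measurableSet fun u hu => ?_
    simp only [waveKernel, hR u (mem_sphere_zero_iff_norm.1 hu)]
  -- inversion of the Radon transform, by linearity from the indicators of balls
  have hinv : ∀ x, sphereMean (sumProfile κ A c fun s => (tailProfile m b s : ℂ)) 0 x = φ x := by
    intro x
    have hbn : (‖b‖ : ℂ) ≠ 0 := by simpa using hb
    have hqn : 1 - (q K : ℂ)⁻¹ ≠ 0 := by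
      rw [sub_ne_zero, ne_comm, ne_eq, inv_eq_one]
      exact_mod_cast hq.ne'
    simp only [sphereMean, sumProfile_add_dotProduct]
    simp only [zero_add]
    have hint : ∀ a : Fin (m + 1) → K, IntegrableOn
        (fun u : Fin (m + 1) → K => c a * (tailProfile m b (u ⬝ᵥ (x - a)) : ℂ)) (sphere 0 1)
        (haarPi K (Fin (m + 1))) := by
      intro a
      have hd : Continuous fun u : Fin (m + 1) → K => u ⬝ᵥ (x - a) := by
        simp only [dotProduct]; fun_prop
      exact (continuous_const.mul (hl1.continuous.comp hd)).continuousOn.integrableOn_compact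
        (isCompact_sphere _ _)
    rw [integral_const_mul, integral_finsetSum _ fun a _ => hint a, hAc x, Finset.mul_sum]
    refine Finset.sum_congr rfl fun a _ => ?_
    rw [integral_const_mul, setIntegral_sphere_tailProfile hK hb, hκ]
    calc (1 - (q K : ℂ)⁻¹)⁻¹ * (‖b‖ : ℂ) ^ m *
          (c a * ((1 - (q K : ℂ)⁻¹) / (‖b‖ : ℂ) ^ m * ballIndicator ‖b‖ (x - a))) =
        ((1 - (q K : ℂ)⁻¹)⁻¹ * (1 - (q K : ℂ)⁻¹)) * ((‖b‖ : ℂ) ^ m / (‖b‖ : ℂ) ^ m) *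
          (c a * ballIndicator ‖b‖ (x - a)) := by ring
      _ = c a * ballIndicator ‖b‖ (x - a) := by
        rw [inv_mul_cancel₀ hqn, div_self (pow_ne_zero _ hbn), one_mul, one_mul]
  refine ⟨fun t x => ⟨fun u hu => ?_, ?_, ?_⟩, ⟨?_, ?_⟩, ?_, fun x => ⟨?_, ?_⟩⟩
  · simp only [waveKernel, hR u hu]
    obtain ⟨C, hC⟩ := (hG ((‖b‖ : ℂ) ^ m)).bounded
    rw [hm]
    refine fracDExists_of_isLocConst hK m.cast_nonneg ?_ (fun s => hC u _) t
    obtain ⟨δ, hδ, h⟩ := (hG ((‖b‖ : ℂ) ^ m)).locConst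
    exact ⟨δ, hδ, fun s s' hs' => by
      simp only [add_right_comm s s']
      exact h u _ _ hs'⟩
  · exact ((hG1 ((‖b‖ : ℂ) ^ m)).integrableOn t x).congr_fun
      (fun u hu => (hR1 t x u (mem_sphere_zero_iff_norm.1 hu)).symm) isClosed_sphere.measurableSet
  · exact ((hG ((‖b‖ : ℂ) ^ m)).integrableOn t x).congr_fun
      (fun u hu => by simp only [waveKernel, hR u (mem_sphere_zero_iff_norm.1 hu)])
      isClosed_sphere.measurableSet
  · rw [hF1]
    exact (hG1 κ).isClassicalSolution hK hn
  · rw [hF1]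
    exact hinv
  · rw [hF2]
    exact (hG κ).isClassicalSolution hK hn
  · rw [hm, hF2]
    obtain ⟨C, hC⟩ := (hG κ).bounded
    obtain ⟨δ, hδ, h⟩ := (hG κ).isLocConst_sphereMean
    refine fracDExists_of_isLocConst hK m.cast_nonneg ⟨δ, hδ, fun s s' hs' => ?_⟩
      (fun s => norm_sphereMean_le hC s x) 0
    simpa using h (s, x) (s', 0) (by simp [Prod.norm_def, hs'])
  · rw [hm, hF2, (hG κ).fracD_sphereMean hK m.cast_nonneg, ← hinv x]
    exact sphereMean_congr (fun u s _ => by rw [hD]) 0 x
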